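/- **Protocol.** Alice emits $N_{\rm em}$ blocks of three pulses. For uniformly random bits $b^{(1)}b^{(2)}b^{(3)}$ a block is in the state $\bigotimes_{u=1}^3\hat\rho^{\,b^{(u)}}_{S_u}$, with purifications $|\psi_{u,b}\rangle_{S_uR_u}$ whose systems $R_u$ stay with Alice. Eve's attack is an arbitrary isometry from all pulses to Bob's $N_{\rm em}$ systems, Eve's system $E$ and an environment that nobody accesses; Bob's system of a block is either flagged "not detected" or a qutrit with basis $|1\rangle,|2\rangle,|3\rangle$ (the one photon found in the first and second time slots comes from the $l$-th pulse). In a detected block Bob measures $\hat\Pi_{j,d}=|\Pi_{j,d}\rangle\langle\Pi_{j,d}|$, $|\Pi_{j,d}\rangle=\big(\sqrt{w_j}|j\rangle+(-1)^d\sqrt{w_{j+1}}|j+1\rangle\big)/\sqrt2$ with $w_1=w_3=1$, $w_2=1/2$, to get a slot $j\in\{1,2\}$ and a bit $d$; the block becomes a code block with probability $t\in(0,1)$ and a sample block otherwise. The sets of code and sample blocks, the slots, and both parties' bits in the sample blocks are announced (the *experimental data*). Alice's sifted key consists of the bits $b^{(j)}\oplus b^{(j+1)}$ of the $N_{\rm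 code}$ code blocks. She sends a syndrome ($N_{\rm EC}$ bits) and a $\zeta'$-bit verification hash of it, each encrypted with a fresh uniformly random pre-shared key, and the choice of the verification hash function is public. Finally she applies a publicly announced, uniformly random binary matrix of full rank $N_{\rm fin}$ to her sifted key. Here $N_{\rm fin}=\max(0,\lfloor N_{\rm code}-N_{\rm PA}\rfloor)$, where $N_{\rm PA}$ is a function of the experimental data. **Phase errors.** Replace Alice's preparation by preparing three qubits and the pulses in $2^{-3/2}\bigotimes_{u}\sum_{b}\hat H|b\rangle|\psi_{u,b}\rangle$. In the code blocks let Alice measure her qubits in the $Z$ basis, with outcomes $z_1z_2z_3$, and let Bob, with operators $w_j|j\rangle\langle j|$ and $w_{j+1}|j+1\rangle\langle j+1|$ for slot $j$, find which of the two interfering pulses contains the photon. A code block has a phase error if the photon is found at $j$ and $z_{j+1}=1$, or at $j+1$ and $z_j=1$. $N_{\rm ph}$ is the number of phase errors in the code blocks. **Secrecy.** For a class of attacks, the protocol is $\epsilon_s$-secret if for every attack in the class $$\frac12\sum_{n\ge0}\Pr[N_{\rm fin}=n]\,\big\|\hat\rho^{\rm fin}_{AE|n}-\hat\rho^{\rm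 ideal}_{AE|n}\big\|_1\le\epsilon_s ,$$ where $\|X\|_1=\mathrm{tr}\sqrt{X^\dagger X}$, $\hat\rho^{\rm fin}_{AE|n}$ is the joint state of Alice's final key and of Eve's systems (her quantum system and all public communication described above), conditioned on $N_{\rm fin}=n$, and $\hat\rho^{\rm ideal}_{AE|n}=2^{-n}\sum_{k\in\{0,1\}^n}|k\rangle\langle k|\otimes\mathrm{tr}_A\,\hat\rho^{\rm fin}_{AE|n}$. **Theorem.** Let $h(x)=-x\log_2x-(1-x)\log_2(1-x)$ for $0\le x\le\frac12$ and $h(x)=1$ for $x>\frac12$. Let $0\le\epsilon\le1$, $\zeta>0$, and let $N_{\rm ph}^{\rm U}\ge0$ be a function of the experimental data. Fix any class of attacks (for instance, all attacks). Suppose that for every attack in the class $$\Pr[N_{\rm ph}>N_{\rm ph}^{\rm U}]\le\epsilon ,$$ and that $N_{\rm PA}=N_{\rm code}\,h\!\left(N_{\rm ph}^{\rm U}/N_{\rm code}\right)+\zeta$. Then the protocol is $\epsilon_s$-secret against this class of attacks, with $$\epsilon_s=\sqrt2\,\sqrt{\epsilon+2^{-\zeta}} .$$ -/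

import Mathlib

open scoped BigOperators ENNReal NNReal InnerProductSpace

noncomputable section

namespace DPS

/-! ## Hilbert spaces with a distinguished orthonormal basis

Every Hilbert space is (unitarily equivalent to) `ℓ²(X)` for an index type `X`, and the tensor
product of `ℓ²(X)` and `ℓ²(Y)` is `ℓ²(X × Y)`. All quantum systems below are written this way;
the index types may be infinite (as for optical pulses). -/

/-- The Hilbert space `ℓ²(X)` over `ℂ`. -/
abbrev L2 (X : Type) : Type := lp (fun _ : X => ℂ) 2

theorem summable_sq {X : Type} (v : L2 X) : Summable fun x => ‖v x‖ ^ 2 := by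
  have h := (lp.memℓp v).summable (by norm_num)
  simpa using h

theorem memL2 {X : Type} {f : X → ℂ} (h : Summable fun x => ‖f x‖ ^ 2) :
    Memℓp (E := fun _ : X => ℂ) f 2 :=
  memℓp_gen (by simpa using h)

theorem norm_sq_eq {X : Type} (v : L2 X) : ‖v‖ ^ 2 = ∑' x, ‖v x‖ ^ 2 := by
  have h := lp.norm_rpow_eq_tsum (p := 2) (by norm_num) v
  simpa using h

theorem extend_off {X Y β : Type} [Zero β] (f : X ↪ Y) (v : X → β) {y : Y}
    (h : ¬∃ x, f x = y) : Function.extend f v 0 y = 0 := by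
  rw [Function.extend_apply' _ _ _ h]; rfl

theorem embed_aux {X Y : Type} (f : X ↪ Y) (v : X → ℂ) :
    (fun y => ‖Function.extend f v 0 y‖ ^ 2)
      = Function.extend f (fun x => ‖v x‖ ^ 2) 0 := by
  funext y
  by_cases h : ∃ x, f x = y
  · obtain ⟨x, rfl⟩ := h
    rw [f.injective.extend_apply, f.injective.extend_apply]
  · rw [extend_off f _ h, extend_off f _ h]
    simp

theorem embed_mem {X Y : Type} (f : X ↪ Y) (v : L2 X) :
    Memℓp (E := fun _ : Y => ℂ) (Function.extend f v 0) 2 := by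
  refine memL2 ?_
  rw [embed_aux]
  refine (Function.Injective.summable_iff f.injective fun y hy => extend_off f _ hy).1 ?_
  rw [Function.extend_comp f.injective]
  exact summable_sq v

/-- For an injection `f : X ↪ Y`, the isometry `ℓ²(X) → ℓ²(Y)`, `|x⟩ ↦ |f x⟩`. -/
def embed {X Y : Type} (f : X ↪ Y) : L2 X →ₗᵢ[ℂ] L2 Y where
  toFun v := ⟨Function.extend f v 0, embed_mem f v⟩
  map_add' v u := by
    refine lp.ext (funext fun y => ?_)
    change Function.extend f (⇑(v + u)) 0 y
      = Function.extend f (⇑v) 0 y + Function.extend f (⇑u) 0 y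
    by_cases h : ∃ x, f x = y
    · obtain ⟨x, rfl⟩ := h
      rw [f.injective.extend_apply, f.injective.extend_apply, f.injective.extend_apply]
      rfl
    · rw [extend_off f _ h, extend_off f _ h, extend_off f _ h, add_zero]
  map_smul' c v := by
    refine lp.ext (funext fun y => ?_)
    change Function.extend f (⇑(c • v)) 0 y = c * Function.extend f (⇑v) 0 y
    by_cases h : ∃ x, f x = y
    · obtain ⟨x, rfl⟩ := h
      rw [f.injective.extend_apply, f.injective.extend_apply]
      rfl
    · rw [extend_off f _ h, extend_off f _ h, mul_zero]
  norm_map' v := by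
    rw [← sq_eq_sq₀ (norm_nonneg _) (norm_nonneg _), norm_sq_eq, norm_sq_eq]
    change ∑' y, ‖Function.extend f (⇑v) 0 y‖ ^ 2 = _
    rw [show (fun y => ‖Function.extend f (⇑v) 0 y‖ ^ 2) = _ from embed_aux f v,
      tsum_extend_zero f.injective]

/-- For an injection `f : X ↪ Y`, the coordinate restriction `ℓ²(Y) → ℓ²(X)`, `v ↦ v ∘ f`. If
`Y = X × Z` and `f x = (x, z)`, this is the partial bra `1 ⊗ ⟨z|`. -/
def restrict {X Y : Type} (f : X ↪ Y) (v : L2 Y) : L2 X :=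
  ⟨fun x => v (f x), memL2 ((summable_sq v).comp_injective f.injective)⟩

theorem prod_summable {ι X : Type} [Fintype ι] (v : ι → L2 X) :
    Summable fun s : ι → X => ‖∏ i, v i (s i)‖ ^ 2 := by
  classical
  refine summable_of_sum_le (c := ∏ i, ‖v i‖ ^ 2) (fun s => by positivity) (fun F => ?_)
  calc ∑ s ∈ F, ‖∏ i, v i (s i)‖ ^ 2
      ≤ ∑ s ∈ Fintype.piFinset (fun i => F.image fun s => s i), ‖∏ i, v i (s i)‖ ^ 2 := by
        refine Finset.sum_le_sum_of_subset_of_nonneg (fun s hs => ?_)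
          (fun _ _ _ => by positivity)
        exact Fintype.mem_piFinset.2 fun i => Finset.mem_image_of_mem _ hs
    _ = ∏ i, ∑ x ∈ F.image (fun s => s i), ‖v i x‖ ^ 2 := by
        rw [Finset.prod_univ_sum]
        refine Finset.sum_congr rfl fun s _ => ?_
        rw [norm_prod, Finset.prod_pow]
    _ ≤ ∏ i, ‖v i‖ ^ 2 := by
        refine Finset.prod_le_prod (fun i _ => Finset.sum_nonneg fun _ _ => by positivity)
          (fun i _ => ?_)
        rw [norm_sq_eq]
        exact (summable_sq (v i)).sum_le_tsum _ (fun _ _ => by positivity)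

/-- The product vector `⨂ᵢ vᵢ`. -/
def prodVec {ι X : Type} [Fintype ι] (v : ι → L2 X) : L2 (ι → X) :=
  ⟨fun s => ∏ i, v i (s i), memL2 (prod_summable v)⟩

/-- The operator absolute value `√(A† A)`. -/
def absOp {H : Type} [NormedAddCommGroup H] [InnerProductSpace ℂ H] [CompleteSpace H]
    (A : H →L[ℂ] H) : H →L[ℂ] H := CFC.abs A

/-- The trace norm `‖A‖₁ = tr √(A† A)`, the trace being taken in the standard basis. -/
def traceNorm {X : Type} (A : L2 X →L[ℂ] L2 X) : ℝ≥0∞ :=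
  open Classical in
  ∑' x : X, ENNReal.ofReal
    (RCLike.re ⟪(lp.single 2 x (1 : ℂ) : L2 X), absOp A (lp.single 2 x (1 : ℂ))⟫_ℂ)

/-- `x ↦ (k, x)`; `embed (inr k)` is `v ↦ |k⟩ ⊗ v`. -/
def inr {K X : Type} (k : K) : X ↪ K × X := ⟨fun x => (k, x), Prod.mk_right_injective k⟩

/-- `|k⟩⟨k| ⊗ B` on `ℓ²(K) ⊗ ℓ²(X)`. -/
def ketBra {K X : Type} (k : K) (B : L2 X →L[ℂ] L2 X) : L2 (K × X) →L[ℂ] L2 (K × X) :=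
  (embed (inr k)).toContinuousLinearMap ∘L B ∘L
    ContinuousLinearMap.adjoint (embed (inr (X := X) k)).toContinuousLinearMap

/-- The partial trace over the finite-dimensional first factor. -/
def traceFst {K X : Type} [Fintype K] (A : L2 (K × X) →L[ℂ] L2 (K × X)) : L2 X →L[ℂ] L2 X :=
  ∑ k : K, ContinuousLinearMap.adjoint (embed (inr (X := X) k)).toContinuousLinearMap ∘L A ∘L
    (embed (inr k)).toContinuousLinearMap

/-! ## Classical data -/

/-- Three bits, one for each pulse of a block. -/
abbrev Bits3 : Type := Fin 3 → ZMod 2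

/-- Record of one round on Bob's side: `none` if the round is not detected; otherwise the time slot
`j` (`0, 1` for the first and second slot), the measured bit, and `true` if the round is a code
round, `false` if it is a sample round. -/
abbrev BobRec : Type := Option (Fin 2 × ZMod 2 × Bool)

/-- Public record of one round: `none` if the round is not detected, `some (j, none)` for a code
round with time slot `j`, and `some (j, some (a, d))` for a sample round with time slot `j`, in
which Alice's and Bob's announced sample bits are `a` and `d`. -/
abbrev PubRec : Type := Option (Fin 2 × Option (ZMod 2 × ZMod 2))

/-- All data announced before error correction, i.e. `𝒟_code`, `𝒟_samp`, the time slots and both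
sample sequences. This is what is experimentally available. -/
abbrev Data (N : ℕ) : Type := Fin N → PubRec

/-- Is the round a code round? -/
def PubRec.isCode : PubRec → Bool
  | some (_, none) => true
  | _ => false

/-- The code rounds `𝒟_code`. -/
abbrev CodeRounds {N : ℕ} (d : Data N) : Type := {i : Fin N // PubRec.isCode (d i) = true}

/-- `N_code`. -/
def numCode {N : ℕ} (d : Data N) : ℕ := Fintype.card (CodeRounds d)

/-- The bit `b^(j) ⊕ b^(j+1)`. -/
def diffBit (b : Bits3) (j : Fin 2) : ZMod 2 := b j.castSucc + b j.succ

/-- The public record of a round with Alice's bits `b` and Bob's record `y`. -/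
def pubRec (b : Bits3) : BobRec → PubRec
  | none => none
  | some (j, _, true) => some (j, none)
  | some (j, d, false) => some (j, some (diffBit b j, d))

/-- The public data of a run. -/
def pubData {N : ℕ} (b : Fin N → Bits3) (y : Fin N → BobRec) : Data N :=
  fun i => pubRec (b i) (y i)

/-- Alice's sifted key `κ_A`. -/
def siftedKey {N : ℕ} (d : Data N) (b : Fin N → Bits3) (i : CodeRounds d) : ZMod 2 :=
  match d i with
  | some (j, _) => diffBit (b i) j
  | none => 0

/-- The function `h`: the binary entropy up to `1/2`, and `1` beyond. -/
def h (x : ℝ) : ℝ :=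
  if x ≤ 1 / 2 then -x * Real.logb 2 x - (1 - x) * Real.logb 2 (1 - x) else 1

/-- The hash functions of privacy amplification: `n × N_code` binary matrices of full rank `n`. -/
abbrev PAMatrix (n : ℕ) {N : ℕ} (d : Data N) : Type :=
  {M : Matrix (Fin n) (CodeRounds d) (ZMod 2) // Function.Surjective M.mulVec}

/-! ## The protocol -/

/-- The protocol. The pulses live in `ℓ²(S)`, the purifying systems, kept by Alice, in `ℓ²(R)`. -/
structure Protocol (S R : Type) where
  /-- Number of emitted blocks, `N_em`. -/
  N : ℕ
  /-- `ψ u b` is the purification, on the systems `S_u R_u`, of the state of the `u`-th pulse for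
  bit `b`. -/
  ψ : Fin 3 → ZMod 2 → L2 (S × R)
  ψ_norm : ∀ u b, ‖ψ u b‖ = 1
  /-- The probability that a detected round is a code round. -/
  t : ℝ
  t_pos : 0 < t
  t_lt_one : t < 1
  /-- The length `N_EC` of the syndrome information. -/
  NEC : Data N → ℕ
  /-- The syndrome map of the error correcting code, chosen depending on the public data. -/
  syndrome : (d : Data N) → (CodeRounds d → ZMod 2) → (Fin (NEC d) → ZMod 2)
  /-- The length `ζ'` of the verification tag. -/
  ζ' : ℕ
  /-- The set (of indices) from which the hash function used for verification is drawn uniformly. -/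
  Seed : Type
  [seedFintype : Fintype Seed]
  [seedNonempty : Nonempty Seed]
  /-- The hash functions `H_EC` used for verification. -/
  tag : (d : Data N) → Seed → (CodeRounds d → ZMod 2) → (Fin ζ' → ZMod 2)
  /-- The amount of privacy amplification `N_PA`, depending on the public data. -/
  NPA : Data N → ℝ

attribute [instance] Protocol.seedFintype Protocol.seedNonempty

/-- A coherent attack on `N` blocks, with pulses in `ℓ²(S)`: an isometry (Stinespring form of an
arbitrary quantum channel) from all `3 N` pulses to `N` systems of Bob, Eve's system `ℓ²(E)` and an
environment `ℓ²(G)` that nobody accesses. The system of Bob in a block is `ℂ ⊕ ℂ³`: the basis state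
`none` means that the block is not detected, i.e. does not have exactly one photon in total among
the first and second time slots; `some l` for `l = 0, 1, 2` is the state in which this photon
comes from the `(l+1)`-st incoming pulse. Thus everything that happens up to this detection event
(the channel, losses, photons ending up in unused time slots) is part of the isometry. -/
structure Attack (S : Type) (N : ℕ) where
  E : Type
  G : Type
  V : L2 (Fin N × Fin 3 → S) →ₗᵢ[ℂ] L2 ((Fin N → Option (Fin 3)) × E × G)

/-- `s ↦ (s, r)` for families. -/
def withPurif {ι S R : Type} (r : ι → R) : (ι → S) ↪ (ι → S × R) :=
  ⟨fun s i => (s i, r i), fun _ _ hs => funext fun i => congrArg Prod.fst (congrFun hs i)⟩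

/-- `e ↦ (q, e, g)`. -/
def eveAt {Q E G : Type} (q : Q) (g : G) : E ↪ Q × E × G :=
  ⟨fun e => (q, e, g), fun _ _ he => congrArg (fun p => p.2.1) he⟩

/-- The weights `w₁ = w₃ = 1`, `w₂ = 1/2`. -/
def w : Fin 3 → ℝ := ![1, 1 / 2, 1]

/-- The sign `(-1)^a`. -/
def sgn (a : ZMod 2) : ℂ := if a = 0 then 1 else -1

/-- The coefficient `⟨Π_{j,d}|l⟩`, where
`|Π_{j,d}⟩ = (√w_j |j⟩ + (-1)^d √w_{j+1} |j+1⟩) / √2`. -/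
def clickAmp (j : Fin 2) (d : ZMod 2) (l : Fin 3) : ℂ :=
  ((if l = j.castSucc then (√(w j.castSucc) : ℂ) else 0)
    + (if l = j.succ then sgn d * (√(w j.succ) : ℂ) else 0)) / (√2 : ℂ)

/-- The coefficient at `l` of the bra `√w_j ⟨j|` (for `s = 0`) or `√w_{j+1} ⟨j+1|` (for `s = 1`). -/
def positionAmp (j : Fin 2) (s : ZMod 2) (l : Fin 3) : ℂ :=
  if s = 0 then (if l = j.castSucc then (√(w j.castSucc) : ℂ) else 0)
  else (if l = j.succ then (√(w j.succ) : ℂ) else 0)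

/-- One round of the actual protocol: the amplitude of Alice's outcome `a` and Bob's outcome `y`
for Alice's encoded bits `b` and Bob's basis state `q`. Alice's three bits are uniform and
`a = b`; Bob finds whether the round is detected, and if so the slot `j` and the bit `d`. -/
def actualAmp (a b : Bits3) (y : BobRec) (q : Option (Fin 3)) : ℂ :=
  (if a = b then (1 / √8 : ℂ) else 0) *
    match y, q with
    | none, none => 1
    | some (j, d, _), some l => clickAmp j d l
    | _, _ => 0

/-- One round of the virtual protocol which defines phase errors. Alice holds three qubits,
prepared together with the pulses in `2^{-3/2} ∑_b H^{⊗3}|b⟩|ψ_b⟩`. In a code round she measures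
them in the `Z` basis (outcome `a`), and Bob measures, instead of the bit, which of the two
interfering pulses contains the photon: the second component of his record is `0` for the `j`-th
and `1` for the `(j+1)`-st pulse. In other rounds nothing changes with respect to the actual
protocol (Alice measures in the `X` basis). -/
def virtualAmp (a b : Bits3) (y : BobRec) (q : Option (Fin 3)) : ℂ :=
  match y, q with
  | some (j, s, true), some l => (1 / √8 : ℂ) * (∏ u, sgn (a u * b u) / (√2 : ℂ)) * positionAmp j s l
  | _, _ => actualAmp a b y q

/-- Does a round with virtual outcomes `a`, `y` have a phase error? The probability of a phase error
in slot `j` is given by the operator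
`∑_z |z⟩⟨z| ⊗ (w_j δ_{z_{j+1},1} |j⟩⟨j| + w_{j+1} δ_{z_j,1} |j+1⟩⟨j+1|)`. -/
def phaseError (a : Bits3) : BobRec → Bool
  | some (j, s, true) => if s = 0 then a j.succ = 1 else a j.castSucc = 1
  | _ => false

/-- The number of phase errors `N_ph` for given outcomes of the virtual protocol. -/
def numPhaseErrors {N : ℕ} (a : Fin N → Bits3) (y : Fin N → BobRec) : ℕ :=
  Fintype.card {i : Fin N // phaseError (a i) (y i) = true}

namespace Protocol

variable {S R : Type} (π : Protocol S R)

/-- Alice's and Bob's outcomes in all rounds, cf. `actualAmp` and `virtualAmp`. -/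
abbrev Outcome : Type := (Fin π.N → Bits3) × (Fin π.N → BobRec)

/-- The public data of a run. -/
def data (o : π.Outcome) : Data π.N := pubData o.1 o.2

/-- The length `N_fin = N_code - N_PA` of the final key, rounded down to an integer, and zero (no
key) if that is negative. -/
def keyLength (d : Data π.N) : ℕ := ⌊(numCode d : ℝ) - π.NPA d⌋₊

/-- The (unnormalized) component, at the basis vector `r` of the purifying systems, of the state of
all pulses when Alice's bits are `b`. -/
def pulses (b : Fin π.N → Bits3) (r : Fin π.N × Fin 3 → R) : L2 (Fin π.N × Fin 3 → S) :=
  restrict (withPurif r) (prodVec fun p : Fin π.N × Fin 3 => π.ψ p.2 (b p.1 p.2))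

/-- The probability that Bob makes the code/sample choices in `y`, given the detected rounds. -/
def labelProb (y : Fin π.N → BobRec) : ℝ :=
  ∏ i, match y i with
    | none => 1
    | some (_, _, true) => π.t
    | some (_, _, false) => 1 - π.t

variable (A : Attack S π.N)

/-- The basis of the systems that are traced out: purifications and environment. -/
abbrev Env : Type := (Fin π.N × Fin 3 → R) × A.G

/-- Eve's unnormalized state vector for the outcomes `o`, at a basis vector of the systems that
are traced out; `amp` is `actualAmp` or `virtualAmp`. -/
def eveVec (amp : Bits3 → Bits3 → BobRec → Option (Fin 3) → ℂ) (o : π.Outcome) (p : π.Env A) :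
    L2 A.E :=
  ∑ b : Fin π.N → Bits3, ∑ q : Fin π.N → Option (Fin 3),
    (∏ i, amp (o.1 i) (b i) (o.2 i) (q i)) • restrict (eveAt q p.2) (A.V (π.pulses b p.1))

/-- The probability of the outcomes `o`. -/
def prob (amp : Bits3 → Bits3 → BobRec → Option (Fin 3) → ℂ) (o : π.Outcome) : ℝ :=
  π.labelProb o.2 * ∑' p : π.Env A, ‖π.eveVec A amp o p‖ ^ 2

/-- `Pr[N_ph > N_ph^U]`, where the bound `N_ph^U` is a function of the experimental data. -/
def phaseErrorProb (NU : Data π.N → ℝ≥0) : ℝ :=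
  ∑ o : π.Outcome,
    if (NU (π.data o) : ℝ) < numPhaseErrors o.1 o.2 then π.prob A virtualAmp o else 0

/-- `Pr[N_fin = n]`. -/
def lengthProb (n : ℕ) : ℝ :=
  ∑ o : π.Outcome, if π.keyLength (π.data o) = n then π.prob A actualAmp o else 0

/-- Everything that is publicly communicated in a run with final key length `n`: the public data,
the encrypted syndrome, the verification hash function, the encrypted verification tag and the hash
function of privacy amplification. -/
abbrev Transcript (n : ℕ) : Type :=
  Σ d : {d : Data π.N // π.keyLength d = n},
    (Fin (π.NEC d) → ZMod 2) × π.Seed × (Fin π.ζ' → ZMod 2) × PAMatrix n d.1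

/-- Basis of Alice's final key and Eve's systems. Eve's systems are a register with the transcript
and her quantum system. -/
abbrev KeyEve (n : ℕ) : Type := (Fin n → ZMod 2) × (π.Transcript n × A.E)

/-- `e ↦ (k, τ, e)`. -/
def keyEve {n : ℕ} (k : Fin n → ZMod 2) (τ : π.Transcript n) : A.E ↪ π.KeyEve A n :=
  ⟨fun e => (k, τ, e), fun _ _ he => congrArg (fun p => p.2.2) he⟩

open Classical in
/-- The state of Alice's final key and Eve's systems restricted to the event `N_fin = n`, of trace
`Pr[N_fin = n]`. The pre-shared keys `c`, `c'` and the hash functions are uniformly random. -/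
def finalStateSub (n : ℕ) : L2 (π.KeyEve A n) →L[ℂ] L2 (π.KeyEve A n) :=
  ∑ d : {d : Data π.N // π.keyLength d = n},
    ∑ o : π.Outcome, if π.data o = d.1 then
      ∑ c : Fin (π.NEC d) → ZMod 2, ∑ seed : π.Seed, ∑ c' : Fin π.ζ' → ZMod 2,
      ∑ M : PAMatrix n d.1,
        ((π.labelProb o.2 / (2 ^ π.NEC d * Fintype.card π.Seed * 2 ^ π.ζ' *
          Fintype.card (PAMatrix n d.1)) : ℝ) : ℂ) •
        ∑' p : π.Env A,
          let κ := siftedKey d.1 o.1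
          let v := embed (π.keyEve A (M.1.mulVec κ)
            ⟨d, π.syndrome d κ + c, seed, π.tag d seed κ + c', M⟩) (π.eveVec A actualAmp o p)
          InnerProductSpace.rankOne ℂ v v
    else 0

/-- The state `ρ^fin_{AE|N_fin}` for `N_fin = n`. -/
def finalState (n : ℕ) : L2 (π.KeyEve A n) →L[ℂ] L2 (π.KeyEve A n) :=
  (((π.lengthProb A n)⁻¹ : ℝ) : ℂ) • π.finalStateSub A n

/-- The state `ρ^ideal_{AE|N_fin}` for `N_fin = n`: a uniform key, independent of Eve's state. -/
def idealState (n : ℕ) : L2 (π.KeyEve A n) →L[ℂ] L2 (π.KeyEve A n) :=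
  ((1 / 2 ^ n : ℝ) : ℂ) • ∑ k : Fin n → ZMod 2, ketBra k (traceFst (π.finalState A n))

/-- The protocol is `εs`-secret against the attacks in the class `𝒜` (all attacks, or those that are
compatible with a given physical receiver):
`(1/2) ∑_n Pr[N_fin = n] ‖ρ^fin_{AE|n} - ρ^ideal_{AE|n}‖₁ ≤ εs`. -/
def IsSecret (𝒜 : Set (Attack S π.N)) (εs : ℝ) : Prop :=
  ∀ A ∈ 𝒜,
    (1 / 2 : ℝ≥0∞) * ∑' n : ℕ, ENNReal.ofReal (π.lengthProb A n) *
      traceNorm (π.finalState A n - π.idealState A n) ≤ ENNReal.ofReal εs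

end Protocol

end DPS

end

/-! Bob's bits in the code rounds are never announced, so replacing his click measurement there by a
measurement of the photon's position leaves Eve's states unchanged (`sum_rankOne_actual`). Once the
position is known, a sifted bit can be flipped by flipping Alice's bit of the interfering pulse that
does not contain the photon. For fixed public data, binary strings thus act on the outcomes by
translating the sifted key. The conjugate variable is Alice's `Z` value at that pulse, which is the
phase error bit: the component of Eve's vectors transforming with the character `x` has the weight
of the phase error pattern `x` in the virtual protocol (`sum_norm_sq_virtual`).

Fix the public data, a basis vector of the traced-out systems and a full-rank hash matrix `M`.
Averaging Eve's vectors over all translations, twisted by `x`, gives vectors `u x` whose rank-one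
operators sum to the ideal state. Averaging only over the kernel of `M` gives vectors depending on
`x` modulo the row space of `M`; summed over a set `R` of coset representatives they give the actual
hashed state. Call them `v x`, put to zero outside `R`. Both families have the same total squared
norm `W`, and their overlap is the `u`-weight of `R`. Hence their squared distance is twice the
weight `Q` of the patterns outside `R`, and the trace distance is controlled by `α * Q + 2 * W / α`
for every `α > 0` (`exists_nucBound_keyState_sub`).

So `Q` is the failure weight of decoding the phase error pattern from its coset. Let `R` prefer
patterns within the error bound. Patterns beyond the bound have total weight at most `ε`. A pattern
within it is missed only if it differs from another such pattern by a row-space element; all nonzero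
vectors are equally likely to lie in the row space, so a union bound and the entropy bound for
Hamming balls give relative weight at most `2 ^ (-ζ)` (`sum_sum_notMem_le`, `card_mul_pow_le`).

One-time pads make the syndrome and tag independent of the key. For fixed `α` all bounds are linear
in the weights, so they add up over environment, hash functions and data to `α * δ + 2 / α` with `δ
= ε + 2 ^ (-ζ)`. The minimum over `α` is `2 * √2 * √δ`, and half of it is the claim. -/

noncomputable section

namespace DPS

/-! ## The trace norm by duality -/

open Classical in
/-- The basis vector `|x⟩`. -/
def ket {X : Type} (x : X) : L2 X := lp.single 2 x (1 : ℂ)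

theorem inner_ket {X : Type} (x : X) (v : L2 X) : ⟪ket x, v⟫_ℂ = v x := by
  classical
  simp only [ket]
  rw [lp.inner_single_left]
  simp

theorem inner_ket_right {X : Type} (x : X) (v : L2 X) :
    ⟪v, ket x⟫_ℂ = (starRingEnd ℂ) (v x) := by
  rw [← inner_conj_symm, inner_ket]

theorem norm_ket {X : Type} (x : X) : ‖(ket x : L2 X)‖ = 1 := by
  classical
  simp only [ket]
  rw [lp.norm_single (by norm_num)]
  simp

/-- `c` bounds `|tr (U A)|` (the trace being cut off to finitely many basis vectors) for all
contractions `U`; this is a bound on the trace norm of `A` which is linear in `A`. -/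
def NucBound {X : Type} (A : L2 X →L[ℂ] L2 X) (c : ℝ) : Prop :=
  ∀ (F : Finset X) (U : L2 X →L[ℂ] L2 X), ‖U‖ ≤ 1 → ‖∑ x ∈ F, ⟪ket x, U (A (ket x))⟫_ℂ‖ ≤ c

namespace NucBound

variable {X Y : Type} {A B : L2 X →L[ℂ] L2 X} {c d : ℝ}

theorem nonneg (h : NucBound A c) : 0 ≤ c := by
  simpa using h ∅ 0 (by simp)

theorem mono (h : NucBound A c) (hcd : c ≤ d) : NucBound A d :=
  fun F U hU => (h F U hU).trans hcd

theorem zero : NucBound (0 : L2 X →L[ℂ] L2 X) 0 := fun F U _ => by simp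

theorem add (hA : NucBound A c) (hB : NucBound B d) : NucBound (A + B) (c + d) := fun F U hU => by
  simp only [add_apply, map_add, inner_add_right, Finset.sum_add_distrib]
  exact (norm_add_le _ _).trans (add_le_add (hA F U hU) (hB F U hU))

theorem smul (hA : NucBound A c) (a : ℂ) : NucBound (a • A) (‖a‖ * c) := fun F U hU => by
  simp only [smul_apply, map_smul, inner_smul_right, ← Finset.mul_sum]
  rw [norm_mul]
  exact mul_le_mul_of_nonneg_left (hA F U hU) (norm_nonneg _)

theorem sum {ι : Type*} (s : Finset ι) {A : ι → L2 X →L[ℂ] L2 X} {c : ι → ℝ}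
    (h : ∀ i ∈ s, NucBound (A i) (c i)) : NucBound (∑ i ∈ s, A i) (∑ i ∈ s, c i) := by
  classical
  induction s using Finset.induction_on with
  | empty => simpa using zero
  | insert i s hi ih =>
    rw [Finset.sum_insert hi, Finset.sum_insert hi]
    exact (h i (by simp)).add (ih fun j hj => h j (by simp [hj]))

/-- Each test functional involves finitely many basis vectors and is therefore norm continuous. This
lets infinite sums over the environment be handled term by term. -/
theorem of_tendsto {ι : Type*} {l : Filter ι} [l.NeBot] {A : ι → L2 X →L[ℂ] L2 X}
    {B : L2 X →L[ℂ] L2 X} (hA : Filter.Tendsto A l (nhds B)) (h : ∀ i, NucBound (A i) c) :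
    NucBound B c := fun F U hU => by
  have hc : Continuous fun T : L2 X →L[ℂ] L2 X => ‖∑ x ∈ F, ⟪ket x, U (T (ket x))⟫_ℂ‖ := by
    fun_prop
  exact le_of_tendsto ((hc.tendsto B).comp hA) (Filter.Eventually.of_forall fun i => h i F U hU)

theorem hasSum {ι : Type*} {A : ι → L2 X →L[ℂ] L2 X} {c : ι → ℝ} (hA : HasSum A B)
    (hc : HasSum c d) (h : ∀ i, NucBound (A i) (c i)) : NucBound B d :=
  of_tendsto hA fun s => (sum s fun i _ => h i).mono <|
    sum_le_hasSum s (fun i _ => (h i).nonneg) hc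

/-- Cauchy–Schwarz over the finitely many basis vectors tested, followed by Bessel's inequality. -/
theorem rankOne (u v : L2 X) : NucBound (InnerProductSpace.rankOne ℂ u v) (‖u‖ * ‖v‖) := by
  intro F U hU
  have bound : ∀ w : L2 X, √(∑ x ∈ F, ‖w x‖ ^ 2) ≤ ‖w‖ := fun w => by
    refine Real.sqrt_le_iff.2 ⟨norm_nonneg _, ?_⟩
    rw [norm_sq_eq]
    exact (summable_sq w).sum_le_tsum _ fun _ _ => by positivity
  calc ‖∑ x ∈ F, ⟪ket x, U (InnerProductSpace.rankOne ℂ u v (ket x))⟫_ℂ‖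
      ≤ ∑ x ∈ F, ‖U u x‖ * ‖v x‖ := by
        refine (norm_sum_le _ _).trans (Finset.sum_le_sum fun x _ => ?_)
        rw [InnerProductSpace.rankOne_apply, map_smul, inner_smul_right, inner_ket,
          inner_ket_right, norm_mul, RCLike.norm_conj, mul_comm]
    _ ≤ √(∑ x ∈ F, ‖U u x‖ ^ 2) * √(∑ x ∈ F, ‖v x‖ ^ 2) := Real.sum_mul_le_sqrt_mul_sqrt _ _ _
    _ ≤ ‖u‖ * ‖v‖ := by
        refine mul_le_mul ((bound _).trans ?_) (bound _) (Real.sqrt_nonneg _) (norm_nonneg _)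
        exact (U.le_opNorm u).trans (mul_le_of_le_one_left (norm_nonneg _) hU)

end NucBound

theorem embed_apply {X Y : Type} (f : X ↪ Y) (v : L2 X) (x : X) : embed f v (f x) = v x :=
  f.injective.extend_apply _ _ _

theorem embed_apply_of_notMem {X Y : Type} (f : X ↪ Y) (v : L2 X) {y : Y} (h : ¬∃ x, f x = y) :
    embed f v y = 0 := extend_off f _ h

/-- `J A J†` for the isometry `J = embed f`. -/
def conjEmbed {X Y : Type} (f : X ↪ Y) (A : L2 X →L[ℂ] L2 X) : L2 Y →L[ℂ] L2 Y :=
  (embed f).toContinuousLinearMap ∘L A ∘L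
    ContinuousLinearMap.adjoint (embed f).toContinuousLinearMap

theorem embed_ket {X Y : Type} (f : X ↪ Y) (x : X) : embed f (ket x) = ket (f x) := by
  classical
  refine lp.ext (funext fun y => ?_)
  by_cases h : ∃ x, f x = y
  · obtain ⟨z, rfl⟩ := h
    rw [embed_apply]
    simp [ket, Pi.single_apply]
  · rw [embed_apply_of_notMem f _ h]
    have : y ≠ f x := fun hy => h ⟨x, hy.symm⟩
    simp [ket, this]

theorem adjoint_embed_apply {X Y : Type} (f : X ↪ Y) (v : L2 Y) (x : X) :
    ContinuousLinearMap.adjoint (embed f).toContinuousLinearMap v x = v (f x) := by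
  rw [← inner_ket, ContinuousLinearMap.adjoint_inner_right, ← inner_ket, ← embed_ket]
  rfl

/-- A contraction `U` testing `J A J†` becomes the contraction `J† U J` testing `A`. Basis vectors
outside the range of the embedding are annihilated by `J†`. -/
theorem NucBound.conjEmbed {X Y : Type} {A : L2 X →L[ℂ] L2 X} {c : ℝ} (h : NucBound A c)
    (f : X ↪ Y) : NucBound (conjEmbed f A) c := by
  classical
  intro F U hU
  set J := (embed f).toContinuousLinearMap with hJ
  have hJn : ‖J‖ ≤ 1 := (embed f).norm_toContinuousLinearMap_le
  have hket : ∀ x, J (ket x) = ket (f x) := embed_ket f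
  have hadj : ∀ x, ContinuousLinearMap.adjoint J (ket (f x)) = ket x := fun x => by
    refine lp.ext (funext fun z => ?_)
    rw [adjoint_embed_apply]
    simp [ket, Pi.single_apply]
  have hadj0 : ∀ y, (¬∃ x, f x = y) → ContinuousLinearMap.adjoint J (ket y) = 0 := fun y hy => by
    refine lp.ext (funext fun z => ?_)
    rw [adjoint_embed_apply]
    have : f z ≠ y := fun h => hy ⟨z, h⟩
    simp [ket, this]
  have key := h (F.preimage f f.injective.injOn) (ContinuousLinearMap.adjoint J ∘L U ∘L J) (by
    refine (ContinuousLinearMap.opNorm_comp_le _ _).trans ?_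
    refine mul_le_one₀ (by rwa [LinearIsometryEquiv.norm_map]) (norm_nonneg _) ?_
    exact (ContinuousLinearMap.opNorm_comp_le _ _).trans (mul_le_one₀ hU (norm_nonneg _) hJn))
  convert key using 2
  rw [← Finset.sum_preimage f F f.injective.injOn]
  · refine Finset.sum_congr rfl fun x _ => ?_
    simp only [DPS.conjEmbed, ContinuousLinearMap.comp_apply]
    rw [ContinuousLinearMap.adjoint_inner_right, hket, hadj]
  · intro y _ hy
    simp only [DPS.conjEmbed, ContinuousLinearMap.comp_apply]
    rw [hadj0 y fun ⟨x, hx⟩ => hy ⟨x, hx⟩]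
    simp

/-! ### From the dual bound to the trace norm. -/

theorem absOp_nonneg {H : Type} [NormedAddCommGroup H] [InnerProductSpace ℂ H] [CompleteSpace H]
    (A : H →L[ℂ] H) : 0 ≤ absOp A := CFC.abs_nonneg A

/-- The polar decomposition up to `δ`. -/
theorem exists_contraction_absOp_sub {H : Type} [NormedAddCommGroup H] [InnerProductSpace ℂ H]
    [CompleteSpace H] (A : H →L[ℂ] H) {δ : ℝ} (hδ : 0 < δ) :
    ∃ U : H →L[ℂ] H, ‖U‖ ≤ 1 ∧ ‖absOp A - U ∘L A‖ ≤ δ := by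
  set B := absOp A with hB
  have hB0 : 0 ≤ B := absOp_nonneg A
  have hBs : IsSelfAdjoint B := IsSelfAdjoint.of_nonneg hB0
  have hspec : ∀ x ∈ spectrum ℝ B, 0 ≤ x := fun x hx => spectrum_nonneg_of_nonneg hB0 hx
  have hBA : B * B = star A * A := CFC.abs_mul_abs A
  -- The contraction is `(|A| + δ)⁻¹ A†`, a regularised polar part. On the spectrum its norm is
  -- governed by `x / (x + δ) ≤ 1`, and the remainder `|A| - U A` by `δ * x / (x + δ) ≤ δ`.
  set g : ℝ → ℝ := fun x => (x + δ)⁻¹ with hg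
  have hgc : ContinuousOn g (spectrum ℝ B) := by
    refine ContinuousOn.inv₀ (by fun_prop) fun x hx => ?_
    have := hspec x hx
    positivity
  have hid : cfc (fun x : ℝ => x) B = B := cfc_id' ℝ B
  have hgs : star (cfc g B) = cfc g B := (cfc_predicate g B : IsSelfAdjoint _).star_eq
  refine ⟨cfc g B * star A, ?_, ?_⟩
  · have h1 : (cfc g B * star A) * star (cfc g B * star A)
        = cfc (fun x => g x * (x * x * g x)) B := by
      rw [cfc_mul g (fun x => x * x * g x) B hgc (by fun_prop),
        cfc_mul (fun x => x * x) g B (by fun_prop) hgc,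
        cfc_mul (fun x => x) (fun x => x) B (by fun_prop) (by fun_prop), hid, hBA, star_mul, hgs,
        star_star]
      simp only [mul_assoc]
    have h2 : ‖cfc g B * star A‖ * ‖cfc g B * star A‖ ≤ 1 := by
      rw [← CStarRing.norm_self_mul_star, h1]
      refine norm_cfc_le zero_le_one fun x hx => ?_
      have hx0 := hspec x hx
      have : 0 < x + δ := by positivity
      rw [Real.norm_of_nonneg (by simp only [hg]; positivity)]
      simp only [hg]
      rw [show (x + δ)⁻¹ * (x * x * (x + δ)⁻¹) = (x / (x + δ)) ^ 2 by field_simp]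
      refine pow_le_one₀ (by positivity) ((div_le_one this).2 (by linarith))
    nlinarith [norm_nonneg (cfc g B * star A)]
  · have h1 : B - (cfc g B * star A) ∘L A = cfc (fun x => x - g x * (x * x)) B := by
      rw [cfc_sub (fun x => x) (fun x => g x * (x * x)) B (by fun_prop) (by fun_prop),
        cfc_mul g (fun x => x * x) B hgc (by fun_prop),
        cfc_mul (fun x => x) (fun x => x) B (by fun_prop) (by fun_prop), hid, hBA]
      rfl
    rw [h1]
    refine norm_cfc_le hδ.le fun x hx => ?_
    have hx0 := hspec x hx
    have : 0 < x + δ := by positivity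
    simp only [hg]
    rw [show x - (x + δ)⁻¹ * (x * x) = δ * (x / (x + δ)) by field_simp; ring,
      Real.norm_of_nonneg (by positivity)]
    exact mul_le_of_le_one_right hδ.le ((div_le_one this).2 (by linarith))

theorem NucBound.traceNorm_le {X : Type} {A : L2 X →L[ℂ] L2 X} {c : ℝ} (h : NucBound A c) :
    traceNorm A ≤ ENNReal.ofReal c := by
  have hpos : ∀ x : X, 0 ≤ RCLike.re ⟪ket x, absOp A (ket x)⟫_ℂ := fun x => by
    have h0 := absOp_nonneg A
    rw [ContinuousLinearMap.nonneg_iff_isPositive] at h0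
    exact h0.re_inner_nonneg_right _
  refine ENNReal.summable.tsum_le_of_sum_le fun F => ?_
  change ∑ x ∈ F, ENNReal.ofReal (RCLike.re ⟪ket x, absOp A (ket x)⟫_ℂ) ≤ _
  rw [← ENNReal.ofReal_sum_of_nonneg fun x _ => hpos x]
  refine ENNReal.ofReal_le_ofReal (le_of_forall_pos_le_add fun δ hδ => ?_)
  -- The error per basis vector is chosen so that the whole of `F` costs at most `δ`; the `+ 1`
  -- covers empty `F`.
  obtain ⟨U, hU, hUA⟩ := exists_contraction_absOp_sub A
    (show 0 < δ / (F.card + 1) by positivity)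
  have h1 : ∀ x, RCLike.re ⟪ket x, absOp A (ket x)⟫_ℂ
      ≤ RCLike.re ⟪ket x, U (A (ket x))⟫_ℂ + δ / (F.card + 1) := fun x => by
    have : RCLike.re ⟪ket x, (absOp A - U ∘L A) (ket x)⟫_ℂ ≤ δ / (F.card + 1) := by
      refine (RCLike.re_le_norm _).trans ((norm_inner_le_norm _ _).trans ?_)
      rw [norm_ket, one_mul]
      refine (ContinuousLinearMap.le_opNorm _ _).trans ?_
      rwa [norm_ket, mul_one]
    rw [sub_apply, inner_sub_right, map_sub, ContinuousLinearMap.comp_apply] at this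
    linarith
  calc ∑ x ∈ F, RCLike.re ⟪ket x, absOp A (ket x)⟫_ℂ
      ≤ ∑ x ∈ F, (RCLike.re ⟪ket x, U (A (ket x))⟫_ℂ + δ / (F.card + 1)) :=
        Finset.sum_le_sum fun x _ => h1 x
    _ = RCLike.re (∑ x ∈ F, ⟪ket x, U (A (ket x))⟫_ℂ) + F.card * (δ / (F.card + 1)) := by
        rw [Finset.sum_add_distrib, map_sum, Finset.sum_const, nsmul_eq_mul]
    _ ≤ c + δ := by
        refine add_le_add ((RCLike.re_le_norm _).trans (h F U hU)) ?_
        rw [← mul_div_assoc, div_le_iff₀ (by positivity)]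
        nlinarith

/-! ## Characters of `(ZMod 2)^ι` -/

theorem zmod_two_eq_one {a : ZMod 2} (h : a ≠ 0) : a = 1 := by
  revert h; revert a; decide

@[simp] theorem sgn_zero : sgn 0 = 1 := by simp [sgn]

@[simp] theorem sgn_one : sgn 1 = -1 := by simp [sgn]

theorem sgn_add (a b : ZMod 2) : sgn (a + b) = sgn a * sgn b := by
  have h1 : (1 : ZMod 2) + 1 = 0 := rfl
  by_cases ha : a = 0
  · simp [ha]
  by_cases hb : b = 0
  · simp [hb]
  simp [zmod_two_eq_one ha, zmod_two_eq_one hb, h1]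

@[simp] theorem conj_sgn (a : ZMod 2) : (starRingEnd ℂ) (sgn a) = sgn a := by
  unfold sgn; split_ifs <;> simp

theorem zmod_two_add_self {ι : Type*} (κ : ι → ZMod 2) : κ + κ = 0 :=
  funext fun i => CharTwo.add_self_eq_zero (κ i)

theorem zmod_two_add_eq_zero {ι : Type*} {κ κ' : ι → ZMod 2} : κ + κ' = 0 ↔ κ = κ' := by
  refine ⟨fun h => ?_, fun h => by rw [h, zmod_two_add_self]⟩
  rw [← add_zero κ, ← zmod_two_add_self κ', ← add_assoc, h, zero_add]

section Fourier

variable {ι : Type*} [Fintype ι] [DecidableEq ι]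

theorem sum_sgn_dotProduct (κ : ι → ZMod 2) :
    ∑ x : ι → ZMod 2, sgn (x ⬝ᵥ κ) = if κ = 0 then (2 : ℂ) ^ Fintype.card ι else 0 := by
  split_ifs with h
  · subst h
    simp [Finset.card_univ]
  · obtain ⟨i, hi⟩ : ∃ i, κ i ≠ 0 := by
      by_contra! h'
      exact h (funext h')
    -- Translating `x` by the basis vector at a coordinate where `κ` is nonzero flips every sign.
    have h1 : ∑ x : ι → ZMod 2, sgn (x ⬝ᵥ κ) = -∑ x : ι → ZMod 2, sgn (x ⬝ᵥ κ) := by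
      rw [← Finset.sum_neg_distrib, ← Equiv.sum_comp (Equiv.addRight (Pi.single i (1 : ZMod 2)))]
      refine Finset.sum_congr rfl fun x _ => ?_
      rw [Equiv.coe_addRight, add_dotProduct, sgn_add, single_dotProduct, one_mul,
        zmod_two_eq_one hi]
      simp
    exact self_eq_neg.1 h1

/-- Parseval's identity for the quadratic form of a sesquilinear map. -/
theorem sum_sgn_parseval {H V : Type*} [AddCommGroup H] [Module ℂ H] [AddCommGroup V] [Module ℂ V]
    (β : H → H → V) (hl : ∀ (s : Finset (ι → ZMod 2)) (g : (ι → ZMod 2) → H) (v : H),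
      β (∑ i ∈ s, g i) v = ∑ i ∈ s, β (g i) v)
    (hr : ∀ (s : Finset (ι → ZMod 2)) (g : (ι → ZMod 2) → H) (v : H),
      β v (∑ i ∈ s, g i) = ∑ i ∈ s, β v (g i))
    (hs : ∀ (a b : ZMod 2) (u v : H), β (sgn a • u) (sgn b • v) = (sgn a * sgn b) • β u v)
    (s : Finset (ι → ZMod 2)) (g : (ι → ZMod 2) → H) :
    ∑ x : ι → ZMod 2, β (∑ κ ∈ s, sgn (x ⬝ᵥ κ) • g κ) (∑ κ ∈ s, sgn (x ⬝ᵥ κ) • g κ)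
      = (2 : ℂ) ^ Fintype.card ι • ∑ κ ∈ s, β (g κ) (g κ) := by
  simp only [hl, hr, hs]
  rw [Finset.sum_comm, Finset.smul_sum]
  refine Finset.sum_congr rfl fun κ hκ => ?_
  rw [Finset.sum_comm]
  simp only [← sgn_add, ← dotProduct_add, ← Finset.sum_smul, sum_sgn_dotProduct,
    zmod_two_add_eq_zero]
  simp [hκ, ite_smul]

variable {H : Type*} [NormedAddCommGroup H] [InnerProductSpace ℂ H]

theorem rankOne_smul_smul (c d : ℂ) (u v : H) :
    InnerProductSpace.rankOne ℂ (c • u) (d • v)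
      = (c * (starRingEnd ℂ) d) • InnerProductSpace.rankOne ℂ u v := by
  rw [(InnerProductSpace.rankOne ℂ).map_smul c u, smul_apply,
    (InnerProductSpace.rankOne ℂ u).map_smulₛₗ, smul_smul]

theorem sum_sgn_rankOne (s : Finset (ι → ZMod 2)) (g : (ι → ZMod 2) → H) :
    ∑ x : ι → ZMod 2, InnerProductSpace.rankOne ℂ (∑ κ ∈ s, sgn (x ⬝ᵥ κ) • g κ)
        (∑ κ ∈ s, sgn (x ⬝ᵥ κ) • g κ)
      = (2 : ℂ) ^ Fintype.card ι • ∑ κ ∈ s, InnerProductSpace.rankOne ℂ (g κ) (g κ) := by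
  refine sum_sgn_parseval (fun u v => InnerProductSpace.rankOne ℂ u v)
    (fun s g v => ?_) (fun s g v => ?_) (fun a b u v => ?_) s g
  · simp [map_sum]
  · simp [map_sum]
  · rw [rankOne_smul_smul, conj_sgn]

theorem sum_sgn_norm_sq (s : Finset (ι → ZMod 2)) (g : (ι → ZMod 2) → H) :
    ∑ x : ι → ZMod 2, ‖∑ κ ∈ s, sgn (x ⬝ᵥ κ) • g κ‖ ^ 2
      = 2 ^ Fintype.card ι * ∑ κ ∈ s, ‖g κ‖ ^ 2 := by
  have h := sum_sgn_parseval (V := ℂ) (fun u v : H => ⟪u, v⟫_ℂ)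
    (fun s g v => sum_inner _ _ _) (fun s g v => inner_sum _ _ _) (fun a b u v => by
      simp only [inner_smul_left, inner_smul_right, conj_sgn, smul_eq_mul]; ring) s g
  simp only [inner_self_eq_norm_sq_to_K, smul_eq_mul] at h
  apply Complex.ofReal_injective
  push_cast
  simpa using h

end Fourier

/-! ## The action of the key space -/

section Action

variable {ι : Type*} [Fintype ι] [DecidableEq ι] {B : Type*} [Fintype B]
  {H : Type*} [NormedAddCommGroup H] [InnerProductSpace ℂ H]
  {T : (ι → ZMod 2) → B → B} (hT0 : ∀ b, T 0 b = b)
  (hT : ∀ κ κ' b, T (κ + κ') b = T κ (T κ' b))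

/-- The average of `f` over the translates in `s`, twisted by the character `x`. -/
def charAvg (T : (ι → ZMod 2) → B → B) (s : Finset (ι → ZMod 2)) (f : B → H) (x : ι → ZMod 2)
    (b : B) : H :=
  (s.card : ℂ)⁻¹ • ∑ κ ∈ s, sgn (x ⬝ᵥ κ) • f (T κ b)

include hT0 hT

omit [Fintype ι] [DecidableEq ι] [Fintype B] in
theorem action_involutive (κ : ι → ZMod 2) : Function.Involutive (T κ) := fun b => by
  rw [← hT, zmod_two_add_self, hT0]

omit [Fintype ι] [DecidableEq ι] in
theorem sum_action {V : Type*} [AddCommMonoid V] (κ : ι → ZMod 2) (g : B → V) :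
    ∑ b, g (T κ b) = ∑ b, g b :=
  Equiv.sum_comp (action_involutive hT0 hT κ).toPerm g

omit [Fintype B] hT0 in
-- The average over the full group is an eigenvector of every translation, because a translation
-- only reindexes the sum.
theorem charAvg_univ_action (f : B → H) (x κ : ι → ZMod 2) (b : B) :
    charAvg T Finset.univ f x (T κ b) = sgn (x ⬝ᵥ κ) • charAvg T Finset.univ f x b := by
  unfold charAvg
  rw [smul_comm, Finset.smul_sum (r := sgn (x ⬝ᵥ κ)),
    ← Equiv.sum_comp (Equiv.addRight κ) (fun κ' => sgn (x ⬝ᵥ κ) • sgn (x ⬝ᵥ κ') • f (T κ' b))]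
  congr 1
  refine Finset.sum_congr rfl fun κ' _ => ?_
  rw [Equiv.coe_addRight, smul_smul, ← sgn_add, dotProduct_add, add_left_comm,
    CharTwo.add_self_eq_zero, add_zero, hT]

/-- Parseval on each orbit removes the cross terms, and every translate of `f` has the same total
weight. -/
theorem sum_norm_sq_charAvg (s : Finset (ι → ZMod 2)) (f : B → H) :
    ∑ x, ∑ b, ‖charAvg T s f x b‖ ^ 2
      = 2 ^ Fintype.card ι / s.card * ∑ b, ‖f b‖ ^ 2 := by
  have h1 : ∀ b, ∑ x, ‖charAvg T s f x b‖ ^ 2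
      = ((s.card : ℝ)⁻¹) ^ 2 * (2 ^ Fintype.card ι * ∑ κ ∈ s, ‖f (T κ b)‖ ^ 2) := fun b => by
    rw [← sum_sgn_norm_sq, Finset.mul_sum]
    refine Finset.sum_congr rfl fun x _ => ?_
    rw [charAvg, norm_smul, mul_pow]
    simp
  rw [Finset.sum_comm, Finset.sum_congr rfl fun b _ => h1 b, ← Finset.mul_sum, ← Finset.mul_sum,
    Finset.sum_comm, Finset.sum_congr rfl fun κ _ => sum_action hT0 hT κ (fun b => ‖f b‖ ^ 2),
    Finset.sum_const, nsmul_eq_mul]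
  rcases eq_or_ne (s.card : ℝ) 0 with h | h
  · simp [h]
  · field_simp

/-- The sign of each translate of `f` is absorbed by the full average, an eigenvector with that very
character. All translates then contribute equally, so the overlap does not depend on `s`. -/
theorem sum_inner_charAvg {s : Finset (ι → ZMod 2)} (hs : s.Nonempty) (f : B → H)
    (x : ι → ZMod 2) :
    ∑ b, ⟪charAvg T Finset.univ f x b, charAvg T s f x b⟫_ℂ
      = ∑ b, ⟪charAvg T Finset.univ f x b, f b⟫_ℂ := by
  have hc : (s.card : ℂ) ≠ 0 := by simpa using hs.ne_empty
  have h1 : ∀ b, ⟪charAvg T Finset.univ f x b, charAvg T s f x b⟫_ℂ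
      = (s.card : ℂ)⁻¹ * ∑ κ ∈ s, ⟪charAvg T Finset.univ f x (T κ b), f (T κ b)⟫_ℂ := fun b => by
    conv_lhs => rw [charAvg.eq_1 T s, inner_smul_right, inner_sum]
    congr 1
    refine Finset.sum_congr rfl fun κ _ => ?_
    rw [charAvg_univ_action hT, inner_smul_left, inner_smul_right, conj_sgn]
  rw [Finset.sum_congr rfl fun b _ => h1 b, ← Finset.mul_sum, Finset.sum_comm,
    Finset.sum_congr rfl fun κ _ => sum_action hT0 hT κ
      (fun b => ⟪charAvg T Finset.univ f x b, f b⟫_ℂ), Finset.sum_const, nsmul_eq_mul]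
  field_simp

/-- By independence of the averaging set, `s` may be replaced by the whole group; the overlap
becomes the weight of `x`. -/
theorem sum_re_inner_charAvg {s : Finset (ι → ZMod 2)} (hs : s.Nonempty) (f : B → H)
    (x : ι → ZMod 2) :
    ∑ b, RCLike.re ⟪charAvg T Finset.univ f x b, charAvg T s f x b⟫_ℂ
      = ∑ b, ‖charAvg T Finset.univ f x b‖ ^ 2 := by
  rw [← map_sum, sum_inner_charAvg hT0 hT hs, ← sum_inner_charAvg hT0 hT Finset.univ_nonempty,
    map_sum]
  exact Finset.sum_congr rfl fun b _ => inner_self_eq_norm_sq _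

end Action

/-! ## Privacy amplification for one pure state -/

section Hash

variable {ι : Type*} [Fintype ι] [DecidableEq ι] {m : ℕ}

theorem card_fiber_mulVec {M : Matrix (Fin m) ι (ZMod 2)} (hM : Function.Surjective M.mulVec)
    (k : Fin m → ZMod 2) :
    (Finset.univ.filter fun κ => M.mulVec κ = k).card
      = (Finset.univ.filter fun κ => M.mulVec κ = 0).card :=
  AddMonoidHom.card_fiber_eq_of_mem_range M.mulVecLin.toAddMonoidHom (hM k) ⟨0, map_zero _⟩

theorem sum_mulVec {V : Type*} [AddCommMonoid V] {M : Matrix (Fin m) ι (ZMod 2)}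
    (hM : Function.Surjective M.mulVec) (g : (Fin m → ZMod 2) → V) :
    ∑ κ, g (M.mulVec κ) = (Finset.univ.filter fun κ => M.mulVec κ = 0).card • ∑ k, g k := by
  rw [← Finset.sum_fiberwise (s := Finset.univ) (g := M.mulVec), Finset.smul_sum]
  refine Finset.sum_congr rfl fun k _ => ?_
  rw [← card_fiber_mulVec hM k, ← Finset.sum_const]
  exact Finset.sum_congr rfl fun κ hκ => by rw [(Finset.mem_filter.1 hκ).2]

theorem card_ker_mul {M : Matrix (Fin m) ι (ZMod 2)} (hM : Function.Surjective M.mulVec) :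
    (Finset.univ.filter fun κ => M.mulVec κ = 0).card * 2 ^ m = 2 ^ Fintype.card ι := by
  have h := sum_mulVec hM (fun _ => 1)
  simpa [Finset.card_univ] using h.symm

/-- A set `R` containing exactly one element of each coset of the row space of `M`. -/
def IsTransversal (M : Matrix (Fin m) ι (ZMod 2)) (R : Finset (ι → ZMod 2)) : Prop :=
  ∀ x, ∃! y : Fin m → ZMod 2, x + Matrix.vecMul y M ∈ R

theorem IsTransversal.sum_eq {V : Type*} [AddCommMonoid V] {M : Matrix (Fin m) ι (ZMod 2)}
    {R : Finset (ι → ZMod 2)} (hR : IsTransversal M R) (F : (ι → ZMod 2) → V)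
    (hF : ∀ x y, F (x + Matrix.vecMul y M) = F x) :
    ∑ x, F x = 2 ^ m • ∑ x ∈ R, F x := by
  classical
  have h1 : ∀ x, F x = ∑ y : Fin m → ZMod 2, if x + Matrix.vecMul y M ∈ R
      then F (x + Matrix.vecMul y M) else 0 := fun x => by
    obtain ⟨y, hy, hu⟩ := hR x
    rw [Finset.sum_eq_single y, if_pos hy, hF]
    · exact fun y' _ hy' => if_neg fun h => hy' (hu y' h)
    · simp
  have h2 : ∀ y : Fin m → ZMod 2, (∑ x, if x + Matrix.vecMul y M ∈ R
      then F (x + Matrix.vecMul y M) else 0) = ∑ x ∈ R, F x := fun y =>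
    (Equiv.sum_comp (Equiv.addRight (Matrix.vecMul y M)) fun x => if x ∈ R then F x else 0).trans
      (Fintype.sum_ite_mem R F)
  rw [Finset.sum_congr rfl fun x _ => h1 x, Finset.sum_comm, Finset.sum_congr rfl fun y _ => h2 y]
  simp [Finset.card_univ]

variable {B : Type*} [Fintype B] {X : Type} {T : (ι → ZMod 2) → B → B} (hT0 : ∀ b, T 0 b = b)
  (hT : ∀ κ κ' b, T (κ + κ') b = T κ (T κ' b)) {key : B → ι → ZMod 2}
  (hkey : ∀ κ b, key (T κ b) = key b + κ)

omit [Fintype B] in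
-- Characters coming from the row space are trivial on the kernel of `M`. Hence an average over the
-- kernel sees only the coset of the pattern.
theorem charAvg_ker_add {H : Type*} [NormedAddCommGroup H] [InnerProductSpace ℂ H]
    (T : (ι → ZMod 2) → B → B) (M : Matrix (Fin m) ι (ZMod 2)) (f : B → H)
    (x : ι → ZMod 2) (y : Fin m → ZMod 2) (b : B) :
    charAvg T (Finset.univ.filter fun κ => M.mulVec κ = 0) f (x + Matrix.vecMul y M) b
      = charAvg T (Finset.univ.filter fun κ => M.mulVec κ = 0) f x b := by
  unfold charAvg
  congr 1
  refine Finset.sum_congr rfl fun κ hκ => ?_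
  rw [add_dotProduct, ← Matrix.dotProduct_mulVec, (Finset.mem_filter.1 hκ).2, dotProduct_zero,
    add_zero]

/-- Unnormalized state given the hashed key `k`. -/
def keyState (M : Matrix (Fin m) ι (ZMod 2)) (key : B → ι → ZMod 2) (f : B → L2 X)
    (k : Fin m → ZMod 2) : L2 X →L[ℂ] L2 X :=
  ∑ b with M.mulVec (key b) = k, InnerProductSpace.rankOne ℂ (f b) (f b)

omit [Fintype B] in
theorem sum_rankOne_charAvg (T : (ι → ZMod 2) → B → B) (s : Finset (ι → ZMod 2)) (f : B → L2 X)
    (t : Finset B) :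
    ∑ b ∈ t, ∑ x, InnerProductSpace.rankOne ℂ (charAvg T s f x b) (charAvg T s f x b)
      = ((2 : ℂ) ^ Fintype.card ι / s.card ^ 2) • ∑ κ ∈ s, ∑ b ∈ t,
        InnerProductSpace.rankOne ℂ (f (T κ b)) (f (T κ b)) := by
  rw [Finset.sum_comm (s := s), Finset.smul_sum]
  refine Finset.sum_congr rfl fun b _ => ?_
  have h1 : ∀ x, InnerProductSpace.rankOne ℂ (charAvg T s f x b) (charAvg T s f x b)
      = ((s.card : ℂ)⁻¹ ^ 2) • InnerProductSpace.rankOne ℂ (∑ κ ∈ s, sgn (x ⬝ᵥ κ) • f (T κ b))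
        (∑ κ ∈ s, sgn (x ⬝ᵥ κ) • f (T κ b)) := fun x => by
    rw [charAvg, rankOne_smul_smul, map_inv₀, map_natCast, sq]
  rw [Finset.sum_congr rfl fun x _ => h1 x, ← Finset.smul_sum,
    sum_sgn_rankOne s (fun κ => f (T κ b)), smul_smul]
  congr 1
  rw [inv_pow, div_eq_inv_mul]

omit [DecidableEq ι] in
include hT0 hT hkey in
theorem sum_rankOne_action (M : Matrix (Fin m) ι (ZMod 2)) (f : B → L2 X) (k : Fin m → ZMod 2)
    (κ : ι → ZMod 2) :
    ∑ b with M.mulVec (key b) = k, InnerProductSpace.rankOne ℂ (f (T κ b)) (f (T κ b))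
      = keyState M key f (k + M.mulVec κ) := by
  rw [keyState, Finset.sum_filter, Finset.sum_filter, ← sum_action hT0 hT κ
    fun b => if M.mulVec (key b) = k + M.mulVec κ then _ else _]
  refine Finset.sum_congr rfl fun b _ => ?_
  simp only [hkey, Matrix.mulVec_add, add_left_inj]

include hT0 hT hkey in
-- Summing over characters turns the coherent average into a mixture of all translates, and
-- surjectivity of `M` makes the hashed key uniform. This is the ideal state.
theorem sum_rankOne_charAvg_univ {M : Matrix (Fin m) ι (ZMod 2)}
    (hM : Function.Surjective M.mulVec) (f : B → L2 X) (k : Fin m → ZMod 2) :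
    ∑ b with M.mulVec (key b) = k, ∑ x, InnerProductSpace.rankOne ℂ
        (charAvg T Finset.univ f x b) (charAvg T Finset.univ f x b)
      = ((1 / 2 ^ m : ℝ) : ℂ) • ∑ k', keyState M key f k' := by
  rw [sum_rankOne_charAvg, Finset.sum_congr rfl fun κ _ => sum_rankOne_action hT0 hT hkey M f k κ,
    sum_mulVec hM (fun k' => keyState M key f (k + k')),
    show ∑ k', keyState M key f (k + k') = ∑ k', keyState M key f k' from
      Equiv.sum_comp (Equiv.addLeft k) (keyState M key f),
    ← Nat.cast_smul_eq_nsmul ℂ, smul_smul]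
  congr 1
  have h := card_ker_mul hM
  set K := (Finset.univ.filter fun κ => M.mulVec κ = 0).card
  have h' : (K : ℂ) * 2 ^ m = 2 ^ Fintype.card ι := by exact_mod_cast h
  rw [Finset.card_univ, Fintype.card_fun, ZMod.card]
  push_cast
  rw [← h']
  have hK : (K : ℂ) ≠ 0 := fun h0 => by
    rw [h0, zero_mul] at h'
    exact pow_ne_zero _ two_ne_zero h'.symm
  field_simp

include hT0 hT hkey in
-- Translations in the kernel of `M` do not change the hashed key, so averaging over them reproduces
-- the actual state. Each coset of characters would be counted `2 ^ m` times; `R` counts it once.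
theorem sum_rankOne_charAvg_ker {M : Matrix (Fin m) ι (ZMod 2)}
    (hM : Function.Surjective M.mulVec) {R : Finset (ι → ZMod 2)} (hR : IsTransversal M R)
    (f : B → L2 X) (k : Fin m → ZMod 2) :
    ∑ b with M.mulVec (key b) = k, ∑ x ∈ R, InnerProductSpace.rankOne ℂ
        (charAvg T (Finset.univ.filter fun κ => M.mulVec κ = 0) f x b)
        (charAvg T (Finset.univ.filter fun κ => M.mulVec κ = 0) f x b)
      = keyState M key f k := by
  have h2 : ((2 : ℂ) ^ m) ≠ 0 := pow_ne_zero _ two_ne_zero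
  have h3 := sum_rankOne_charAvg T (Finset.univ.filter fun κ => M.mulVec κ = 0) f
    (Finset.univ.filter fun b => M.mulVec (key b) = k)
  rw [Finset.sum_congr rfl fun b _ => hR.sum_eq (fun x => InnerProductSpace.rankOne ℂ
        (charAvg T (Finset.univ.filter fun κ => M.mulVec κ = 0) f x b)
        (charAvg T (Finset.univ.filter fun κ => M.mulVec κ = 0) f x b))
        fun x y => by rw [charAvg_ker_add],
    ← Finset.smul_sum, ← Nat.cast_smul_eq_nsmul ℂ,
    Finset.sum_congr rfl fun κ hκ => (sum_rankOne_action hT0 hT hkey M f k κ).trans (by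
      rw [(Finset.mem_filter.1 hκ).2, add_zero]), Finset.sum_const, ← Nat.cast_smul_eq_nsmul ℂ,
    smul_smul] at h3
  have h := card_ker_mul hM
  set K := (Finset.univ.filter fun κ => M.mulVec κ = 0).card
  have h' : (K : ℂ) * 2 ^ m = 2 ^ Fintype.card ι := by exact_mod_cast h
  have hK : (K : ℂ) ≠ 0 := fun h0 => by
    rw [h0, zero_mul] at h'
    exact pow_ne_zero _ two_ne_zero h'.symm
  rw [← h', show (K : ℂ) * 2 ^ m / K ^ 2 * K = 2 ^ m by field_simp] at h3
  push_cast at h3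
  exact smul_right_injective _ h2 h3

/-- Polarisation gives the bound `‖u - v‖ * ‖u + v‖`. The weighted mean inequality replaces this
product by squares, so that contributions of many vectors can be added. -/
theorem NucBound.rankOne_sub_rankOne (u v : L2 X) {α : ℝ} (hα : 0 < α) :
    NucBound (InnerProductSpace.rankOne ℂ v v - InnerProductSpace.rankOne ℂ u u)
      ((α * ‖u - v‖ ^ 2 + ‖u + v‖ ^ 2 / α) / 2) := by
  have h1 := ((NucBound.rankOne (v - u) (v + u)).add (NucBound.rankOne (v + u) (v - u))).smul
    (1 / 2 : ℂ)
  have h2 : (1 / 2 : ℂ) • (InnerProductSpace.rankOne ℂ (v - u) (v + u)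
      + InnerProductSpace.rankOne ℂ (v + u) (v - u))
      = InnerProductSpace.rankOne ℂ v v - InnerProductSpace.rankOne ℂ u u := by
    simp only [map_add, map_sub, add_apply, sub_apply]
    module
  rw [h2] at h1
  refine h1.mono ?_
  rw [add_comm v u, norm_sub_rev v u]
  have h3 : ‖u - v‖ * ‖u + v‖ ≤ (α * ‖u - v‖ ^ 2 + ‖u + v‖ ^ 2 / α) / 2 := by
    rw [le_div_iff₀ two_pos, ← mul_le_mul_iff_right₀ hα, mul_add, mul_div_cancel₀ _ hα.ne']
    nlinarith [sq_nonneg (α * ‖u - v‖ - ‖u + v‖)]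
  norm_num
  linarith

include hT0 hT hkey in
/-- If the phase pattern is found correctly by decoding from its class modulo the row space of `M`,
up to the total weight of the patterns outside `R`, the hashed key is almost uniform. -/
theorem exists_nucBound_keyState_sub {M : Matrix (Fin m) ι (ZMod 2)}
    (hM : Function.Surjective M.mulVec) {R : Finset (ι → ZMod 2)} (hR : IsTransversal M R)
    (f : B → L2 X) {α : ℝ} (hα : 0 < α) :
    ∃ c : (Fin m → ZMod 2) → ℝ,
      (∀ k, NucBound (keyState M key f k - ((1 / 2 ^ m : ℝ) : ℂ) • ∑ k', keyState M key f k')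
        (c k)) ∧
      ∑ k, c k ≤ α * ∑ x with x ∉ R, ∑ b, ‖charAvg T Finset.univ f x b‖ ^ 2
        + 2 / α * ∑ b, ‖f b‖ ^ 2 := by
  classical
  set K := Finset.univ.filter fun κ => M.mulVec κ = 0 with hK
  have hK0 : K.Nonempty := ⟨0, by simp [hK]⟩
  set u : (ι → ZMod 2) → B → L2 X := charAvg T Finset.univ f with hu
  -- Extension by zero lets the representatives be compared with all patterns, so `u x` for `x ∉ R`
  -- counts entirely as error.
  set v : (ι → ZMod 2) → B → L2 X := fun x b => if x ∈ R then charAvg T K f x b else 0 with hv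
  refine ⟨fun k => ∑ b with M.mulVec (key b) = k, ∑ x,
    (α * ‖u x b - v x b‖ ^ 2 + ‖u x b + v x b‖ ^ 2 / α) / 2, fun k => ?_, ?_⟩
  · rw [← sum_rankOne_charAvg_ker hT0 hT hkey hM hR, ← sum_rankOne_charAvg_univ hT0 hT hkey hM,
      ← Finset.sum_sub_distrib]
    refine NucBound.sum _ fun b _ => ?_
    rw [← Fintype.sum_ite_mem R, ← Finset.sum_sub_distrib]
    refine NucBound.sum _ fun x _ => ?_
    have := NucBound.rankOne_sub_rankOne (u x b) (v x b) hα
    convert this using 2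
    by_cases hx : x ∈ R <;> simp [hv, hx, hK]
  · rw [Finset.sum_fiberwise]
    set W := ∑ b, ‖f b‖ ^ 2 with hW
    set Q : (ι → ZMod 2) → ℝ := fun x => ∑ b, ‖u x b‖ ^ 2 with hQ
    have hu2 : ∑ b, ∑ x, ‖u x b‖ ^ 2 = W := by
      rw [Finset.sum_comm, hu, sum_norm_sq_charAvg hT0 hT]
      simp [Finset.card_univ, hW]
    have hv2 : ∑ b, ∑ x, ‖v x b‖ ^ 2 = W := by
      have h1 := sum_norm_sq_charAvg hT0 hT K f
      rw [hR.sum_eq _ fun x y => by simp only [hK, charAvg_ker_add], nsmul_eq_mul] at h1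
      have h := card_ker_mul hM
      have h' : (K.card : ℝ) * 2 ^ m = 2 ^ Fintype.card ι := by exact_mod_cast h
      have hKc : (K.card : ℝ) ≠ 0 := by simpa using hK0.ne_empty
      rw [← h', mul_div_cancel_left₀ _ hKc] at h1
      push_cast at h1
      have h2 := mul_left_cancel₀ (pow_ne_zero m two_ne_zero) h1
      rw [Finset.sum_comm, hW, ← h2, ← Fintype.sum_ite_mem R]
      refine Finset.sum_congr rfl fun x _ => ?_
      by_cases hx : x ∈ R <;> simp [hv, hx]
    have huv : ∑ b, ∑ x, RCLike.re ⟪u x b, v x b⟫_ℂ = ∑ x ∈ R, Q x := by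
      rw [Finset.sum_comm, ← Fintype.sum_ite_mem R]
      refine Finset.sum_congr rfl fun x _ => ?_
      by_cases hx : x ∈ R
      · simp only [hv, hx, if_true]
        exact sum_re_inner_charAvg hT0 hT hK0 f x
      · simp [hv, hx]
    have hQW : ∑ x ∈ R, Q x + ∑ x with x ∉ R, Q x = W := by
      rw [← hu2, Finset.sum_comm (s := Finset.univ (α := B)),
        ← Finset.sum_filter_add_sum_filter_not Finset.univ (· ∈ R)]
      congr 2
      simp
    -- Expanding gives `2 * W` minus twice the overlap, and the overlap is the weight of `R`.
    have hsub : ∑ b, ∑ x, ‖u x b - v x b‖ ^ 2 = 2 * ∑ x with x ∉ R, Q x := by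
      simp only [norm_sub_sq (𝕜 := ℂ), Finset.sum_add_distrib, Finset.sum_sub_distrib,
        ← Finset.mul_sum, hu2, hv2, huv]
      linarith
    have hadd : ∑ b, ∑ x, ‖u x b + v x b‖ ^ 2 ≤ 4 * W := by
      have hQ0 : 0 ≤ ∑ x with x ∉ R, Q x :=
        Finset.sum_nonneg fun x _ => Finset.sum_nonneg fun b _ => by positivity
      simp only [norm_add_sq (𝕜 := ℂ), Finset.sum_add_distrib,
        ← Finset.mul_sum, hu2, hv2, huv]
      linarith
    have : ∑ b, ∑ x, (α * ‖u x b - v x b‖ ^ 2 + ‖u x b + v x b‖ ^ 2 / α) / 2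
        = (α * ∑ b, ∑ x, ‖u x b - v x b‖ ^ 2 + (∑ b, ∑ x, ‖u x b + v x b‖ ^ 2) / α) / 2 := by
      simp only [← Finset.sum_div, Finset.sum_add_distrib, ← Finset.mul_sum]
    rw [this, hsub]
    have h5 : (∑ b, ∑ x, ‖u x b + v x b‖ ^ 2) / α ≤ 4 * W / α := by gcongr
    have h6 : 4 * W / α = 2 * (2 / α * W) := by ring
    linarith

end Hash

/-! ## Random binary matrices of full rank -/

section Counting

variable {ι : Type*} [Fintype ι] [DecidableEq ι] {m : ℕ}

/-- The `m × ι` binary matrices of full rank `m`. -/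
abbrev FullRank (m : ℕ) (ι : Type*) [Fintype ι] : Type _ :=
  {M : Matrix (Fin m) ι (ZMod 2) // Function.Surjective M.mulVec}

omit [DecidableEq ι] in
theorem vecMul_injective {M : Matrix (Fin m) ι (ZMod 2)} (hM : Function.Surjective M.mulVec) :
    Function.Injective fun y => Matrix.vecMul y M := by
  intro y y' h
  refine dotProduct_eq _ _ fun k => ?_
  obtain ⟨κ, rfl⟩ := hM k
  rw [Matrix.dotProduct_mulVec, Matrix.dotProduct_mulVec]
  exact congrArg (· ⬝ᵥ κ) h

/-- Any two nonzero vectors are exchanged by an involution. -/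
theorem exists_mul_self_eq_one_vecMul {z z' : ι → ZMod 2} (hz : z ≠ 0) (hz' : z' ≠ 0) :
    ∃ g : Matrix ι ι (ZMod 2), g * g = 1 ∧ Matrix.vecMul z g = z' := by
  -- A functional equal to `1` on both vectors: a common coordinate of the supports, or else one
  -- coordinate from each.
  obtain ⟨a, ha, ha'⟩ : ∃ a : ι → ZMod 2, z ⬝ᵥ a = 1 ∧ z' ⬝ᵥ a = 1 := by
    obtain ⟨i, hi⟩ : ∃ i, z i ≠ 0 := by
      by_contra! h
      exact hz (funext h)
    obtain ⟨j, hj⟩ : ∃ j, z' j ≠ 0 := by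
      by_contra! h
      exact hz' (funext h)
    have hi := zmod_two_eq_one hi
    have hj := zmod_two_eq_one hj
    by_cases hi' : z' i = 0
    · by_cases hj' : z j = 0
      · exact ⟨Pi.single i 1 + Pi.single j 1, by simp [dotProduct_add, hi, hj'],
          by simp [dotProduct_add, hj, hi']⟩
      · exact ⟨Pi.single j 1, by simp [zmod_two_eq_one hj'], by simp [hj]⟩
    · exact ⟨Pi.single i 1, by simp [hi], by simp [zmod_two_eq_one hi']⟩
  -- A transvection: it sends `z` to `z + (z + z')`, and its square is `1` because `z + z'` pairs to
  -- zero with `a` in characteristic two.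
  refine ⟨1 + Matrix.vecMulVec a (z + z'), ?_, ?_⟩
  · have h0 : (z + z') ⬝ᵥ a = 0 := by rw [add_dotProduct, ha, ha']; rfl
    have h1 : ∀ A : Matrix ι ι (ZMod 2), A + A = 0 := fun A => by
      ext i j
      exact CharTwo.add_self_eq_zero _
    rw [mul_add, mul_one, add_mul, one_mul, Matrix.vecMulVec_mul_vecMulVec, h0, zero_smul,
      Matrix.vecMulVec_zero, add_zero, add_assoc, h1, add_zero]
  · rw [Matrix.vecMul_add, Matrix.vecMul_one, Matrix.vecMul_vecMulVec, ha, one_smul, ← add_assoc,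
      zmod_two_add_self, zero_add]

open Classical in
/-- The number of full rank matrices whose row space contains `z`. -/
def rowSpaceCount (m : ℕ) (z : ι → ZMod 2) : ℕ :=
  (Finset.univ.filter fun M : FullRank m ι => ∃ y, Matrix.vecMul y M.1 = z).card

/-- Right multiplication by an involution exchanging the two vectors permutes the full-rank matrices
and carries row spaces along. -/
theorem rowSpaceCount_le_of_ne_zero {z z' : ι → ZMod 2} (hz : z ≠ 0) (hz' : z' ≠ 0) :
    rowSpaceCount m z ≤ rowSpaceCount m z' := by
  classical
  obtain ⟨g, hg, hzg⟩ := exists_mul_self_eq_one_vecMul hz hz'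
  have hsurj : ∀ M : FullRank m ι, Function.Surjective (M.1 * g).mulVec := fun M k => by
    obtain ⟨κ, hκ⟩ := M.2 k
    exact ⟨g.mulVec κ, by
      rw [Matrix.mulVec_mulVec, Matrix.mul_assoc, hg, Matrix.mul_one, hκ]⟩
  refine Finset.card_le_card_of_injOn (fun M => ⟨M.1 * g, hsurj M⟩) (fun M hM => ?_)
    (fun M _ M' _ h => ?_)
  · obtain ⟨y, hy⟩ := (Finset.mem_filter.1 hM).2
    simp only [Finset.coe_filter, Finset.mem_univ, true_and, Set.mem_ofPred_eq]
    exact ⟨y, by rw [← Matrix.vecMul_vecMul, hy, hzg]⟩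
  · have h1 := congrArg (· * g) (congrArg Subtype.val h)
    simp only [Matrix.mul_assoc, hg, Matrix.mul_one] at h1
    exact Subtype.ext h1

/-- Double counting of pairs of a matrix and an element of its row space: there are `2 ^ m` elements
per matrix, zero belongs to every row space, and all nonzero vectors occur equally often. -/
theorem rowSpaceCount_mul_le {z : ι → ZMod 2} (hz : z ≠ 0) :
    rowSpaceCount m z * 2 ^ Fintype.card ι ≤ Fintype.card (FullRank m ι) * 2 ^ m := by
  classical
  have h1 : ∑ z : ι → ZMod 2, rowSpaceCount m z = Fintype.card (FullRank m ι) * 2 ^ m := by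
    simp only [rowSpaceCount, Finset.card_filter]
    rw [Finset.sum_comm, Finset.sum_congr rfl fun M _ => (?_ : _ = 2 ^ m)]
    · simp [Finset.card_univ]
    · rw [← Finset.card_filter]
      have : (Finset.univ.filter fun z => ∃ y, Matrix.vecMul y M.1 = z)
          = Finset.univ.image fun y => Matrix.vecMul y M.1 := by
        ext z
        simp
      rw [this, Finset.card_image_of_injective _ (vecMul_injective M.2)]
      simp [Finset.card_univ]
  have h2 : ∑ z : ι → ZMod 2, rowSpaceCount m z
      = rowSpaceCount m (0 : ι → ZMod 2) + ((2 ^ Fintype.card ι - 1) * rowSpaceCount m z) := by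
    rw [← Finset.add_sum_erase _ _ (Finset.mem_univ (0 : ι → ZMod 2)),
      Finset.sum_congr rfl fun z' hz' => (?_ : _ = rowSpaceCount m z)]
    · simp [Finset.card_univ, Finset.card_erase_of_mem]
    · have := (Finset.mem_erase.1 hz').1
      exact le_antisymm (rowSpaceCount_le_of_ne_zero this hz) (rowSpaceCount_le_of_ne_zero hz this)
  have h3 : rowSpaceCount m (0 : ι → ZMod 2) = Fintype.card (FullRank m ι) := by
    rw [rowSpaceCount, Finset.filter_true_of_mem fun M _ => ⟨0, Matrix.zero_vecMul _⟩,
      Finset.card_univ]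
  have h4 : rowSpaceCount m z ≤ Fintype.card (FullRank m ι) := by
    rw [rowSpaceCount, ← Finset.card_univ]
    exact Finset.card_le_card (Finset.filter_subset _ _)
  obtain ⟨q, hq⟩ : ∃ q, 2 ^ Fintype.card ι = q + 1 := ⟨2 ^ Fintype.card ι - 1, by
    have := Nat.one_le_two_pow (n := Fintype.card ι)
    omega⟩
  rw [← h1, h2, h3, hq, Nat.add_sub_cancel]
  nlinarith

/-- Decoding: the representatives of the cosets can be chosen in `G` where possible. -/
theorem exists_isTransversal {M : Matrix (Fin m) ι (ZMod 2)} (hM : Function.Surjective M.mulVec)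
    (G : Finset (ι → ZMod 2)) :
    ∃ R, IsTransversal M R ∧
      ∀ x ∈ G, x ∉ R → ∃ x' ∈ G, x' ≠ x ∧ ∃ y, Matrix.vecMul y M = x + x' := by
  classical
  let S : Setoid (ι → ZMod 2) :=
    { r := fun x x' => ∃ y, Matrix.vecMul y M = x + x'
      iseqv :=
        { refl := fun x => ⟨0, by rw [Matrix.zero_vecMul, zmod_two_add_self]⟩
          symm := fun ⟨y, hy⟩ => ⟨y, by rw [hy, add_comm]⟩
          trans := fun {x₁ x₂ x₃} ⟨y, hy⟩ ⟨y', hy'⟩ => ⟨y + y', by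
            rw [Matrix.add_vecMul, hy, hy', add_assoc, ← add_assoc x₂, zmod_two_add_self,
              zero_add]⟩ } }
  -- A coset meeting `G` gets a representative in `G`; any other coset gets an arbitrary one.
  have hrep : ∀ q : Quotient S, ∃ x, Quotient.mk S x = q ∧
      ((∃ x' ∈ G, Quotient.mk S x' = q) → x ∈ G) := fun q => by
    by_cases h : ∃ x' ∈ G, Quotient.mk S x' = q
    · obtain ⟨x, hx, hq⟩ := h
      exact ⟨x, hq, fun _ => hx⟩
    · exact ⟨q.out, q.out_eq, fun h' => (h h').elim⟩
  choose rep hrep hG using hrep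
  have hshift : ∀ x y, Quotient.mk S (x + Matrix.vecMul y M) = Quotient.mk S x := fun x y =>
    Quotient.sound ⟨y, by rw [add_right_comm, zmod_two_add_self, zero_add]⟩
  refine ⟨Finset.univ.filter fun x => rep (Quotient.mk S x) = x, fun x => ?_, fun x hx hxR => ?_⟩
  · obtain ⟨y, hy⟩ := Quotient.exact (hrep (Quotient.mk S x)).symm
    have hy' : x + Matrix.vecMul y M = rep (Quotient.mk S x) := by
      rw [hy, ← add_assoc, zmod_two_add_self, zero_add]
    refine ⟨y, ?_, fun y' hy'' => ?_⟩
    · simp only [Finset.mem_filter, Finset.mem_univ, true_and]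
      rw [hshift, hy']
    · simp only [Finset.mem_filter, Finset.mem_univ, true_and] at hy''
      rw [hshift, ← hy'] at hy''
      exact vecMul_injective hM (add_left_cancel hy'').symm
  · obtain ⟨y, hy⟩ := Quotient.exact (hrep (Quotient.mk S x)).symm
    exact ⟨rep (Quotient.mk S x), hG _ ⟨x, hx, rfl⟩,
      fun h => hxR (by simpa using h), y, hy⟩

/-- Union bound for decoding: a pattern in `G` is missed only if the row space contains its nonzero
difference from another element of `G`. Patterns outside `G` are given up entirely. -/
theorem sum_sum_notMem_le (G : Finset (ι → ZMod 2)) (R : FullRank m ι → Finset (ι → ZMod 2))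
    (hR : ∀ M, ∀ x ∈ G, x ∉ R M → ∃ x' ∈ G, x' ≠ x ∧ ∃ y, Matrix.vecMul y M.1 = x + x')
    {Q : (ι → ZMod 2) → ℝ} (hQ : ∀ x, 0 ≤ Q x) :
    ∑ M, ∑ x with x ∉ R M, Q x ≤ Fintype.card (FullRank m ι) *
      (∑ x with x ∉ G, Q x + G.card * 2 ^ m / 2 ^ Fintype.card ι * ∑ x, Q x) := by
  classical
  have h1 : ∀ x, ((Finset.univ.filter fun M => x ∉ R M).card : ℝ)
      ≤ Fintype.card (FullRank m ι) *
        ((if x ∉ G then 1 else 0) + G.card * 2 ^ m / 2 ^ Fintype.card ι) := fun x => by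
    by_cases hx : x ∈ G
    · have h2 : (Finset.univ.filter fun M => x ∉ R M).card
          ≤ ∑ x' ∈ G.erase x, rowSpaceCount m (x + x') := by
        unfold rowSpaceCount
        refine le_trans (Finset.card_le_card fun M hM => ?_) Finset.card_biUnion_le
        obtain ⟨x', hx', hne, y, hy⟩ := hR M x hx (Finset.mem_filter.1 hM).2
        simp only [Finset.mem_biUnion, Finset.mem_erase, Finset.mem_filter, Finset.mem_univ,
          true_and]
        exact ⟨x', ⟨hne, hx'⟩, y, hy⟩
      have h3 : ∀ x' ∈ G.erase x, (rowSpaceCount m (x + x') : ℝ)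
          ≤ Fintype.card (FullRank m ι) * 2 ^ m / 2 ^ Fintype.card ι := fun x' hx' => by
        rw [le_div_iff₀ (by positivity)]
        exact_mod_cast rowSpaceCount_mul_le fun h =>
          (Finset.mem_erase.1 hx').1 (zmod_two_add_eq_zero.1 h).symm
      have h4 : ((Finset.univ.filter fun M => x ∉ R M).card : ℝ)
          ≤ ∑ x' ∈ G.erase x, (rowSpaceCount m (x + x') : ℝ) := by exact_mod_cast h2
      refine h4.trans ((Finset.sum_le_card_nsmul _ _ _ h3).trans ?_)
      rw [nsmul_eq_mul, if_neg (not_not.2 hx), zero_add]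
      have : ((G.erase x).card : ℝ) ≤ G.card := by exact_mod_cast Finset.card_erase_le
      calc ((G.erase x).card : ℝ) * (Fintype.card (FullRank m ι) * 2 ^ m / 2 ^ Fintype.card ι)
          ≤ G.card * (Fintype.card (FullRank m ι) * 2 ^ m / 2 ^ Fintype.card ι) := by gcongr
        _ = _ := by ring
    · rw [if_pos hx]
      have h2 : ((Finset.univ.filter fun M => x ∉ R M).card : ℝ)
          ≤ Fintype.card (FullRank m ι) := by
        rw [← Finset.card_univ]
        exact_mod_cast Finset.card_le_card (Finset.filter_subset _ _)
      refine h2.trans (le_mul_of_one_le_right (Nat.cast_nonneg _) ?_)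
      have : (0 : ℝ) ≤ G.card * 2 ^ m / 2 ^ Fintype.card ι := by positivity
      linarith
  calc ∑ M, ∑ x with x ∉ R M, Q x
      = ∑ x, ((Finset.univ.filter fun M => x ∉ R M).card : ℝ) * Q x := by
        simp only [Finset.sum_filter, Finset.card_filter, Nat.cast_sum, Finset.sum_mul]
        rw [Finset.sum_comm]
        refine Finset.sum_congr rfl fun x _ => Finset.sum_congr rfl fun M _ => ?_
        split_ifs <;> simp
    _ ≤ ∑ x, Fintype.card (FullRank m ι) *
        ((if x ∉ G then 1 else 0) + G.card * 2 ^ m / 2 ^ Fintype.card ι) * Q x :=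
        Finset.sum_le_sum fun x _ => mul_le_mul_of_nonneg_right (h1 x) (hQ x)
    _ = _ := by
        simp only [Finset.sum_filter, mul_add, add_mul, Finset.sum_add_distrib, Finset.mul_sum]
        congr 1
        · refine Finset.sum_congr rfl fun x _ => ?_
          split_ifs <;> simp
        · exact Finset.sum_congr rfl fun x _ => by ring

/-! ## Hamming balls -/

/-- The number of patterns of relative weight at most `s ≤ 1 / 2` is at most `2 ^ (n h(s))`. -/
theorem card_hammingBall_le {s : ℝ} (hs0 : 0 ≤ s) (hs : s ≤ 1 / 2) :
    ((Finset.univ.filter fun x : ι → ZMod 2 =>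
      ((Finset.univ.filter fun i => x i = 1).card : ℝ) ≤ s * Fintype.card ι).card : ℝ)
      ≤ 2 ^ (Fintype.card ι * h s) := by
  set n := Fintype.card ι
  -- At `s = 0` the logarithm takes its default value and `2 ^ logb 2 s = s` fails; the ball is then
  -- just the zero pattern.
  rcases hs0.eq_or_lt with rfl | hs0
  · have h0 : h 0 = 0 := by simp [h]
    rw [h0, mul_zero, Real.rpow_zero]
    have : (Finset.univ.filter fun x : ι → ZMod 2 =>
      ((Finset.univ.filter fun i => x i = 1).card : ℝ) ≤ 0 * n) ⊆ {0} := fun x hx => by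
      simp only [Finset.mem_filter, Finset.mem_univ, true_and, zero_mul] at hx
      have hx : (Finset.univ.filter fun i => x i = 1).card = 0 := by
        exact_mod_cast le_antisymm hx (Nat.cast_nonneg _)
      rw [Finset.card_eq_zero, Finset.filter_eq_empty_iff] at hx
      refine Finset.mem_singleton.2 (funext fun i => ?_)
      by_contra hi
      exact hx (Finset.mem_univ i) (zmod_two_eq_one hi)
    exact_mod_cast Finset.card_le_card this
  -- Under independent bits of bias `s`, each pattern in the ball has probability at least `2 ^ (-(n
  -- * h s))`, so there cannot be more than the inverse of that number.
  have h1 : ∑ x : ι → ZMod 2, ∏ i, (if x i = 1 then s else 1 - s) = 1 := by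
    have := Finset.prod_univ_sum (fun _ : ι => (Finset.univ : Finset (ZMod 2)))
      (fun _ a => if a = 1 then s else 1 - s)
    rw [Fintype.piFinset_univ] at this
    rw [← this]
    refine Finset.prod_eq_one fun i _ => ?_
    change ∑ a : Fin 2, (if (a : ZMod 2) = 1 then s else 1 - s) = 1
    rw [Fin.sum_univ_two]
    simp
  have h2 : ∀ x : ι → ZMod 2, ((Finset.univ.filter fun i => x i = 1).card : ℝ) ≤ s * n →
      (2 : ℝ) ^ (-(n * h s)) ≤ ∏ i, (if x i = 1 then s else 1 - s) := fun x hx => by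
    have h3 : (Finset.univ.filter fun i => x i = 1).card
        + (Finset.univ.filter fun i => ¬x i = 1).card = n :=
      Finset.card_filter_add_card_filter_not _
    rw [Finset.prod_ite, Finset.prod_const, Finset.prod_const]
    set a := (Finset.univ.filter fun i => x i = 1).card
    set b := (Finset.univ.filter fun i => ¬x i = 1).card
    have h3 : (a : ℝ) + b = n := by exact_mod_cast h3
    have hs1 : 0 < 1 - s := by linarith
    have h4 : s ^ a * (1 - s) ^ b
        = (2 : ℝ) ^ (a * Real.logb 2 s + b * Real.logb 2 (1 - s)) := by
      rw [Real.rpow_add two_pos, mul_comm (a : ℝ), mul_comm (b : ℝ), Real.rpow_mul two_pos.le,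
        Real.rpow_mul two_pos.le, Real.rpow_logb two_pos (by norm_num) hs0,
        Real.rpow_logb two_pos (by norm_num) hs1, Real.rpow_natCast, Real.rpow_natCast]
    rw [h4]
    refine Real.rpow_le_rpow_of_exponent_le one_le_two ?_
    -- Here `s ≤ 1 / 2` enters: fewer ones can only raise the probability.
    have h5 : Real.logb 2 s ≤ Real.logb 2 (1 - s) :=
      Real.logb_le_logb_of_le one_lt_two hs0 (by linarith)
    rw [h, if_pos hs]
    rw [show (b : ℝ) = n - a by linarith]
    linarith [mul_nonneg (sub_nonneg.2 hx) (sub_nonneg.2 h5)]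
  set G := Finset.univ.filter fun x : ι → ZMod 2 =>
      ((Finset.univ.filter fun i => x i = 1).card : ℝ) ≤ s * n
  have h6 : (G.card : ℝ) * 2 ^ (-(n * h s)) ≤ 1 := by
    rw [← h1, ← nsmul_eq_mul]
    refine (Finset.card_nsmul_le_sum G _ _ fun x hx => h2 x (Finset.mem_filter.1 hx).2).trans ?_
    refine Finset.sum_le_sum_of_subset_of_nonneg (Finset.subset_univ _) fun x _ _ =>
      Finset.prod_nonneg fun i _ => ?_
    split_ifs <;> linarith
  rwa [Real.rpow_neg two_pos.le, ← div_eq_mul_inv, div_le_one (by positivity)] at h6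

end Counting

/-! ## Isometric recombination of finite families -/

section Mixing

variable {O Z H V : Type*} [Fintype O] [Fintype Z] [DecidableEq Z] [AddCommGroup H] [Module ℂ H]
  [AddCommGroup V] [Module ℂ V]

/-- Weighted orthogonality of the columns of `U` kills all cross terms. The form is abstract so that
one computation serves both rank-one operators and squared norms. -/
theorem sum_isometry (β : H → H → V)
    (hl : ∀ (g : Z → H) (v : H), β (∑ i, g i) v = ∑ i, β (g i) v)
    (hr : ∀ (g : Z → H) (v : H), β v (∑ i, g i) = ∑ i, β v (g i))
    (hs : ∀ (c d : ℂ) (u v : H), β (c • u) (d • v) = (c * (starRingEnd ℂ) d) • β u v)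
    {U : O → Z → ℂ} {w : O → ℂ} {c : Z → ℂ}
    (hU : ∀ z z', ∑ o, w o * (U o z * (starRingEnd ℂ) (U o z')) = if z = z' then c z else 0)
    (v : Z → H) :
    ∑ o, w o • β (∑ z, U o z • v z) (∑ z, U o z • v z) = ∑ z, c z • β (v z) (v z) := by
  simp only [hl, hr, hs, Finset.smul_sum, smul_smul]
  rw [Finset.sum_comm]
  refine Finset.sum_congr rfl fun z _ => ?_
  rw [Finset.sum_comm]
  simp only [← Finset.sum_smul, hU, ite_smul, zero_smul]
  simp

variable {E : Type*} [NormedAddCommGroup E] [InnerProductSpace ℂ E]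

theorem sum_isometry_rankOne {U : O → Z → ℂ} {w : O → ℂ} {c : Z → ℂ}
    (hU : ∀ z z', ∑ o, w o * (U o z * (starRingEnd ℂ) (U o z')) = if z = z' then c z else 0)
    (v : Z → E) :
    ∑ o, w o • InnerProductSpace.rankOne ℂ (∑ z, U o z • v z) (∑ z, U o z • v z)
      = ∑ z, c z • InnerProductSpace.rankOne ℂ (v z) (v z) :=
  sum_isometry (fun u v => InnerProductSpace.rankOne ℂ u v) (fun g v => by simp)
    (fun g v => by simp) rankOne_smul_smul hU v

theorem sum_isometry_norm_sq {U : O → Z → ℂ} {w : O → ℝ} {c : Z → ℝ}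
    (hU : ∀ z z', ∑ o, (w o : ℂ) * (U o z * (starRingEnd ℂ) (U o z'))
      = if z = z' then (c z : ℂ) else 0)
    (v : Z → E) :
    ∑ o, w o * ‖∑ z, U o z • v z‖ ^ 2 = ∑ z, c z * ‖v z‖ ^ 2 := by
  have h := sum_isometry (V := ℂ) (fun u v : E => ⟪v, u⟫_ℂ) (fun g v => inner_sum _ _ _)
    (fun g v => sum_inner _ _ _) (fun c d u v => by
      simp only [inner_smul_left, inner_smul_right, smul_eq_mul]; ring) hU v
  simp only [inner_self_eq_norm_sq_to_K, smul_eq_mul] at h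
  apply Complex.ofReal_injective
  push_cast
  simpa using h

end Mixing

/-! ## Outcomes as families of single round outcomes -/

theorem sum_outcome {V : Type*} [AddCommMonoid V] {ι A B : Type*} [Fintype ι] [DecidableEq ι]
    [Fintype A] [Fintype B] (F : (ι → A) × (ι → B) → V) :
    ∑ o, F o = ∑ z : ι → A × B, F (fun i => (z i).1, fun i => (z i).2) :=
  (Equiv.sum_comp (Equiv.arrowProdEquivProdArrow ι (fun _ => A) (fun _ => B)) F).symm

theorem sum_prod_outcome {R : Type*} [CommSemiring R] {ι A B : Type*} [Fintype ι] [DecidableEq ι]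
    [Fintype A] [Fintype B] (F : ι → A → B → R) :
    ∑ o : (ι → A) × (ι → B), ∏ i, F i (o.1 i) (o.2 i) = ∏ i, ∑ a, ∑ b, F i a b := by
  rw [sum_outcome]
  simp only [← Fintype.sum_prod_type']
  rw [Finset.prod_univ_sum, Fintype.piFinset_univ]

theorem prod_ite_eq {R : Type*} [CommSemiring R] {ι A B : Type*} [Fintype ι]
    [DecidableEq A] [DecidableEq B] [DecidableEq (ι → A)] [DecidableEq (ι → B)]
    (z z' : (ι → A) × (ι → B)) (c : ι → R) :
    ∏ i, (if z.1 i = z'.1 i ∧ z.2 i = z'.2 i then c i else 0)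
      = if z = z' then ∏ i, c i else 0 := by
  split_ifs with h
  · subst h; simp
  · obtain ⟨i, hi⟩ : ∃ i, ¬(z.1 i = z'.1 i ∧ z.2 i = z'.2 i) := by
      by_contra! h'
      exact h (Prod.ext (funext fun i => (h' i).1) (funext fun i => (h' i).2))
    exact Finset.prod_eq_zero (Finset.mem_univ i) (if_neg hi)

/-! ## The single round amplitudes -/

/-- One round in which Alice announces nothing new and Bob, in code rounds, finds which of the two
interfering pulses contains the photon. -/
def keyAmp (a b : Bits3) (y : BobRec) (q : Option (Fin 3)) : ℂ :=
  match y, q with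
  | some (j, s, true), some l => (if a = b then (1 / √8 : ℂ) else 0) * positionAmp j s l
  | _, _ => actualAmp a b y q

/-- The change of basis from the position of the photon to Bob's bit in code rounds. -/
def bobMix (y y' : BobRec) : ℂ :=
  match y, y' with
  | some (j, d, true), some (j', s, true) => if j = j' then sgn (d * s) / (√2 : ℂ) else 0
  | _, _ => if y = y' then 1 else 0

/-- The change of Alice's basis from `X` to `Z` in code rounds. -/
def aliceMix (y : BobRec) (a a' : Bits3) : ℂ :=
  match y with
  | some (_, _, true) => ∏ u, sgn (a u * a' u) / (√2 : ℂ)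
  | _ => if a = a' then 1 else 0

theorem sum_zmod_two {V : Type*} [AddCommMonoid V] (F : ZMod 2 → V) : ∑ s, F s = F 0 + F 1 :=
  Fin.sum_univ_two F

theorem clickAmp_eq (j : Fin 2) (d : ZMod 2) (l : Fin 3) :
    clickAmp j d l = ∑ s : ZMod 2, sgn (d * s) / (√2 : ℂ) * positionAmp j s l := by
  rw [sum_zmod_two, mul_zero, mul_one, sgn_zero]
  simp only [clickAmp, positionAmp, if_true, one_ne_zero, if_false]
  split_ifs <;> ring

/-- Bob's click amplitudes are the Hadamard transform of the position amplitudes at the same slot,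
so only his unannounced bit is mixed. -/
theorem actualAmp_eq (a b : Bits3) (y : BobRec) (q : Option (Fin 3)) :
    actualAmp a b y q = ∑ a', ∑ y', (if a = a' then bobMix y y' else 0) * keyAmp a' b y' q := by
  simp only [ite_mul, zero_mul, Finset.sum_ite_irrel, Finset.sum_const_zero, Finset.sum_ite_eq,
    Finset.mem_univ, if_true]
  rcases y with _ | ⟨j, d, _ | _⟩
  · rw [Finset.sum_eq_single none] <;> simp +contextual [bobMix, keyAmp, eq_comm]
  · rw [Finset.sum_eq_single (some (j, d, false))] <;>
      simp +contextual [bobMix, keyAmp, eq_comm]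
  · rcases q with _ | l
    · rw [Finset.sum_eq_zero]
      · simp [actualAmp]
      · rintro (_ | ⟨j', s, _ | _⟩) _ <;> simp [bobMix, keyAmp, actualAmp]
    · simp only [Fintype.sum_option, Fintype.sum_prod_type, Fintype.sum_bool]
      simp only [bobMix, keyAmp, actualAmp, clickAmp_eq, sum_zmod_two]
      simp
      fin_cases j <;> simp <;> split_ifs <;> ring

/-- The virtual protocol also arises from `keyAmp`, by a Hadamard transform on Alice's side only.
`keyAmp` is the common refinement that links it to the actual protocol. -/
theorem virtualAmp_eq (a b : Bits3) (y : BobRec) (q : Option (Fin 3)) :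
    virtualAmp a b y q
      = ∑ a', ∑ y', (if y = y' then aliceMix y a a' else 0) * keyAmp a' b y' q := by
  simp only [ite_mul, zero_mul, Finset.sum_ite_eq, Finset.mem_univ, if_true]
  rcases y with _ | ⟨j, d, _ | _⟩
  · simp [aliceMix, keyAmp, virtualAmp]
  · simp [aliceMix, keyAmp, virtualAmp]
  · rcases q with _ | l
    · simp [aliceMix, keyAmp, virtualAmp, actualAmp]
    · simp only [aliceMix, keyAmp, virtualAmp]
      simp
      ring

theorem bobMix_orthogonal (y y' : BobRec) :
    ∑ x, bobMix x y * (starRingEnd ℂ) (bobMix x y') = if y = y' then 1 else 0 := by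
  have h2 : ((√2 : ℝ) : ℂ) * (√2 : ℝ) = 2 := by
    rw [← Complex.ofReal_mul, Real.mul_self_sqrt two_pos.le]; simp
  have h3 : (1 / (√2 : ℝ) : ℂ) * (1 / (√2 : ℝ)) = 1 / 2 := by
    rw [div_mul_div_comm, h2, mul_one]
  rcases y with _ | ⟨j, d, _ | _⟩ <;> rcases y' with _ | ⟨j', d', _ | _⟩
  all_goals simp only [Fintype.sum_option, Fintype.sum_prod_type, Fintype.sum_bool]
  all_goals simp [bobMix]
  · fin_cases j <;> fin_cases j' <;> simp [eq_comm]
  · by_cases hj : j = j'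
    · have h4 : 1 + sgn d * sgn d' = if d = d' then 2 else 0 := by
        by_cases hd : d = 0 <;> by_cases hd' : d' = 0
        · simp [hd, hd']; norm_num
        · simp [hd, zmod_two_eq_one hd']
        · simp [zmod_two_eq_one hd, hd']
        · simp [zmod_two_eq_one hd, zmod_two_eq_one hd']; norm_num
      have h5 : (if d = d' then 1 else 0 : ℂ) = (1 + sgn d * sgn d') / 2 := by
        rw [h4]
        split_ifs <;> norm_num
      simp only [hj, true_and, if_true, map_div₀, conj_sgn, Complex.conj_ofReal, sum_zmod_two, h5,
        zero_mul, one_mul, sgn_zero]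
      linear_combination (1 + sgn d * sgn d') * h3
    · simp [hj]

theorem prod_sgn_div (a b : Bits3) :
    ∏ u, sgn (a u * b u) / (√2 : ℂ) = sgn (a ⬝ᵥ b) / (√8 : ℂ) := by
  have h8 : √8 = √2 * √2 * √2 := by
    rw [Real.mul_self_sqrt two_pos.le, show (8 : ℝ) = 2 ^ 2 * 2 by norm_num,
      Real.sqrt_mul (by norm_num), Real.sqrt_sq two_pos.le]
  rw [Fin.prod_univ_three, dotProduct, Fin.sum_univ_three, sgn_add, sgn_add, h8]
  push_cast
  ring

theorem aliceMix_orthogonal (y : BobRec) (a a' : Bits3) :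
    ∑ x, aliceMix y x a * (starRingEnd ℂ) (aliceMix y x a') = if a = a' then 1 else 0 := by
  have h8 : ((√8 : ℝ) : ℂ) * (√8 : ℝ) = 8 := by
    rw [← Complex.ofReal_mul, Real.mul_self_sqrt (by norm_num)]; simp
  rcases y with _ | ⟨j, d, _ | _⟩
  · simp [aliceMix, eq_comm]
  · simp [aliceMix, eq_comm]
  · have h1 : ∀ x, aliceMix (some (j, d, true)) x a
        * (starRingEnd ℂ) (aliceMix (some (j, d, true)) x a')
        = sgn (x ⬝ᵥ (a + a')) / 8 := fun x => by
      simp only [aliceMix, prod_sgn_div]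
      rw [map_div₀, conj_sgn, Complex.conj_ofReal, div_mul_div_comm, h8, ← sgn_add,
        ← dotProduct_add]
    simp only [h1]
    rw [← Finset.sum_div, sum_sgn_dotProduct]
    simp only [zmod_two_add_eq_zero]
    split_ifs <;> norm_num

/-- The factor of `Protocol.labelProb` for one round. -/
def roundProb (t : ℝ) : BobRec → ℝ
  | none => 1
  | some (_, _, true) => t
  | some (_, _, false) => 1 - t

/-- Bob's part of `keyAmp`. -/
def bobAmp (y : BobRec) (q : Option (Fin 3)) : ℂ :=
  match y, q with
  | none, none => 1
  | some (j, s, true), some l => positionAmp j s l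
  | some (j, d, false), some l => clickAmp j d l
  | _, _ => 0

theorem keyAmp_eq (a b : Bits3) (y : BobRec) (q : Option (Fin 3)) :
    keyAmp a b y q = (if a = b then (1 / √8 : ℂ) else 0) * bobAmp y q := by
  rcases y with _ | ⟨j, d, _ | _⟩ <;> rcases q with _ | l <;> simp [keyAmp, bobAmp, actualAmp]

/-- The middle pulse can be found in either slot, with weight `1 / 2` each, while the outer pulses
belong to a single slot with weight `1`. Hence the position measurement is complete. -/
theorem sum_positionAmp (l l' : Fin 3) :
    ∑ j, ∑ s, positionAmp j s l * (starRingEnd ℂ) (positionAmp j s l')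
      = if l = l' then 1 else 0 := by
  have h2 : ((√2 : ℝ) : ℂ) * (√2 : ℝ) = 2 := by
    rw [← Complex.ofReal_mul, Real.mul_self_sqrt two_pos.le]; simp
  simp only [Fin.sum_univ_two, sum_zmod_two, positionAmp]
  fin_cases l <;> fin_cases l' <;> simp [w]
  rw [← mul_inv, h2]
  norm_num

theorem sum_clickAmp (j : Fin 2) (l l' : Fin 3) :
    ∑ d, clickAmp j d l * (starRingEnd ℂ) (clickAmp j d l')
      = ∑ s, positionAmp j s l * (starRingEnd ℂ) (positionAmp j s l') := by
  have h2 : ((√2 : ℝ) : ℂ) * (√2 : ℝ) = 2 := by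
    rw [← Complex.ofReal_mul, Real.mul_self_sqrt two_pos.le]; simp
  have h3 : (1 / (√2 : ℝ) : ℂ) * (1 / (√2 : ℝ)) = 1 / 2 := by
    rw [div_mul_div_comm, h2, mul_one]
  simp only [clickAmp_eq, sum_zmod_two, map_add, map_mul, map_div₀, conj_sgn, Complex.conj_ofReal]
  simp only [mul_zero, mul_one, sgn_zero, sgn_one]
  linear_combination (2 * (positionAmp j 0 l * (starRingEnd ℂ) (positionAmp j 0 l')
    + positionAmp j 1 l * (starRingEnd ℂ) (positionAmp j 1 l'))) * h3

theorem bobAmp_isometry (t : ℝ) (q q' : Option (Fin 3)) :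
    ∑ y, (roundProb t y : ℂ) * (bobAmp y q * (starRingEnd ℂ) (bobAmp y q'))
      = if q = q' then 1 else 0 := by
  rcases q with _ | l <;> rcases q' with _ | l'
  · simp [Fintype.sum_option, bobAmp, roundProb]
  · simp [Fintype.sum_option, bobAmp, roundProb]
  · simp [Fintype.sum_option, bobAmp, roundProb]
  · simp only [Fintype.sum_option, Fintype.sum_prod_type, Fintype.sum_bool, bobAmp, roundProb,
      Finset.sum_add_distrib, ← Finset.mul_sum, sum_clickAmp, sum_positionAmp]
    split_ifs with h1 h2 h2 <;> simp_all

theorem keyAmp_isometry (t : ℝ) (b b' : Bits3) (q q' : Option (Fin 3)) :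
    ∑ a, ∑ y, (roundProb t y : ℂ) * (keyAmp a b y q * (starRingEnd ℂ) (keyAmp a b' y q'))
      = if b = b' ∧ q = q' then (1 / 8 : ℂ) else 0 := by
  have h8 : ((√8 : ℝ) : ℂ) * (√8 : ℝ) = 8 := by
    rw [← Complex.ofReal_mul, Real.mul_self_sqrt (by norm_num)]; simp
  have h1 : ∀ a y, (roundProb t y : ℂ) * (keyAmp a b y q * (starRingEnd ℂ) (keyAmp a b' y q'))
      = ((if a = b then (1 / √8 : ℂ) else 0) * (if a = b' then (1 / √8 : ℂ) else 0))
        * ((roundProb t y : ℂ) * (bobAmp y q * (starRingEnd ℂ) (bobAmp y q'))) := fun a y => by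
    rw [keyAmp_eq, keyAmp_eq, map_mul]
    have : (starRingEnd ℂ) (if a = b' then (1 / √8 : ℂ) else 0)
        = if a = b' then (1 / √8 : ℂ) else 0 := by
      split_ifs <;> simp
    rw [this]
    ring
  simp only [h1, ← Finset.mul_sum, bobAmp_isometry]
  rw [← Finset.sum_mul]
  simp only [ite_mul, zero_mul, Finset.sum_ite_eq', Finset.mem_univ, if_true, mul_ite, mul_zero,
    mul_one]
  rw [div_mul_div_comm, h8, one_mul]
  by_cases hb : b = b' <;> by_cases hq : q = q' <;> simp [hb, hq, eq_comm (a := b')]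

/-! ## Norms of restricted vectors -/

theorem ofReal_norm_sq {X : Type} (v : L2 X) :
    ENNReal.ofReal (‖v‖ ^ 2) = ∑' x, ENNReal.ofReal (‖v x‖ ^ 2) := by
  rw [norm_sq_eq, ENNReal.ofReal_tsum_of_nonneg (fun x => by positivity) (summable_sq v)]

theorem restrict_apply {X Y : Type} (f : X ↪ Y) (v : L2 Y) (x : X) : restrict f v x = v (f x) :=
  rfl

theorem tsum_prod_ennreal {α β : Type*} (F : α × β → ℝ≥0∞) :
    ∑' p, F p = ∑' a, ∑' b, F (a, b) :=
  ENNReal.tsum_prod (f := fun a b => F (a, b))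

theorem tsum_ofReal_norm_sq_restrict_withPurif {ι S R : Type} (v : L2 (ι → S × R)) :
    ∑' r, ENNReal.ofReal (‖restrict (withPurif r) v‖ ^ 2) = ENNReal.ofReal (‖v‖ ^ 2) := by
  simp only [ofReal_norm_sq, restrict_apply]
  rw [← (Equiv.arrowProdEquivProdArrow ι (fun _ => S) (fun _ => R)).symm.tsum_eq fun s =>
    ENNReal.ofReal (‖v s‖ ^ 2), tsum_prod_ennreal, ENNReal.tsum_comm]
  rfl

theorem tsum_ofReal_norm_sq_restrict_eveAt {Q E G : Type} [Fintype Q] (v : L2 (Q × E × G)) :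
    ∑' g, ∑ q, ENNReal.ofReal (‖restrict (eveAt q g) v‖ ^ 2) = ENNReal.ofReal (‖v‖ ^ 2) := by
  simp only [ofReal_norm_sq, restrict_apply]
  rw [Summable.tsum_finsetSum fun _ _ => ENNReal.summable, tsum_prod_ennreal, tsum_fintype]
  simp only [tsum_prod_ennreal (α := E)]
  exact Finset.sum_congr rfl fun q _ => ENNReal.tsum_comm

/-- An inequality is enough, since the total probability is only needed as an upper bound. -/
theorem norm_prodVec_sq_le {ι X : Type} [Fintype ι] (v : ι → L2 X) :
    ‖prodVec v‖ ^ 2 ≤ ∏ i, ‖v i‖ ^ 2 := by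
  classical
  rw [norm_sq_eq]
  refine (prod_summable v).tsum_le_of_sum_le fun F => ?_
  calc ∑ s ∈ F, ‖∏ i, v i (s i)‖ ^ 2
      ≤ ∑ s ∈ Fintype.piFinset (fun i => F.image fun s => s i), ‖∏ i, v i (s i)‖ ^ 2 := by
        refine Finset.sum_le_sum_of_subset_of_nonneg (fun s hs => ?_)
          (fun _ _ _ => by positivity)
        exact Fintype.mem_piFinset.2 fun i => Finset.mem_image_of_mem _ hs
    _ = ∏ i, ∑ x ∈ F.image (fun s => s i), ‖v i x‖ ^ 2 := by
        rw [Finset.prod_univ_sum]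
        refine Finset.sum_congr rfl fun s _ => ?_
        rw [norm_prod, Finset.prod_pow]
    _ ≤ ∏ i, ‖v i‖ ^ 2 := by
        refine Finset.prod_le_prod (fun i _ => Finset.sum_nonneg fun _ _ => by positivity)
          (fun i _ => ?_)
        rw [norm_sq_eq]
        exact (summable_sq (v i)).sum_le_tsum _ (fun _ _ => by positivity)

namespace Protocol

variable {S R : Type} (π : Protocol S R) (A : Attack S π.N)

/-- Eve's unnormalized vector for the bits `b` and Bob's basis vector `q`. -/
def branch (b : Fin π.N → Bits3) (q : Fin π.N → Option (Fin 3)) (p : π.Env A) : L2 A.E :=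
  restrict (eveAt q p.2) (A.V (π.pulses b p.1))

/-- Slicing a vector along basis vectors preserves its total squared norm, and the attack is
isometric. Extended nonnegative reals allow sums to be exchanged before summability is known. -/
theorem tsum_ofReal_norm_sq_branch_le (b : Fin π.N → Bits3) :
    ∑' p : π.Env A, ∑ q, ENNReal.ofReal (‖π.branch A b q p‖ ^ 2) ≤ 1 := by
  rw [tsum_prod_ennreal]
  simp only [branch, tsum_ofReal_norm_sq_restrict_eveAt, LinearIsometry.norm_map]
  simp only [pulses, tsum_ofReal_norm_sq_restrict_withPurif]
  rw [← ENNReal.ofReal_one]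
  refine ENNReal.ofReal_le_ofReal ((norm_prodVec_sq_le _).trans_eq ?_)
  simp [π.ψ_norm]

theorem summable_norm_sq_branch (b : Fin π.N → Bits3) :
    Summable fun p : π.Env A => ∑ q, ‖π.branch A b q p‖ ^ 2 := by
  have h := (π.tsum_ofReal_norm_sq_branch_le A b).trans_lt ENNReal.one_lt_top
  simp only [← ENNReal.ofReal_sum_of_nonneg fun q _ => sq_nonneg ‖π.branch A b q _‖] at h
  refine (ENNReal.summable_toReal h.ne).congr fun p => ?_
  exact ENNReal.toReal_ofReal (Finset.sum_nonneg fun q _ => by positivity)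

theorem tsum_norm_sq_branch_le (b : Fin π.N → Bits3) :
    ∑' p : π.Env A, ∑ q, ‖π.branch A b q p‖ ^ 2 ≤ 1 := by
  have h := π.tsum_ofReal_norm_sq_branch_le A b
  simp only [← ENNReal.ofReal_sum_of_nonneg fun q _ => sq_nonneg ‖π.branch A b q _‖] at h
  rw [← ENNReal.ofReal_tsum_of_nonneg (fun p => Finset.sum_nonneg fun q _ => by positivity)
    (π.summable_norm_sq_branch A b)] at h
  exact (ENNReal.ofReal_le_one).1 h

theorem eveVec_eq (amp : Bits3 → Bits3 → BobRec → Option (Fin 3) → ℂ) (o : π.Outcome)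
    (p : π.Env A) :
    π.eveVec A amp o p = ∑ z : (Fin π.N → Bits3) × (Fin π.N → Option (Fin 3)),
      (∏ i, amp (o.1 i) (z.1 i) (o.2 i) (z.2 i)) • π.branch A z.1 z.2 p := by
  rw [Fintype.sum_prod_type]
  rfl

theorem summable_norm_sq_eveVec (amp : Bits3 → Bits3 → BobRec → Option (Fin 3) → ℂ)
    (o : π.Outcome) : Summable fun p : π.Env A => ‖π.eveVec A amp o p‖ ^ 2 := by
  have h : Summable fun p : π.Env A => ∑ z : (Fin π.N → Bits3) × (Fin π.N → Option (Fin 3)),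
      ‖π.branch A z.1 z.2 p‖ ^ 2 := by
    simp only [Fintype.sum_prod_type]
    exact summable_sum fun b _ => π.summable_norm_sq_branch A b
  refine Summable.of_nonneg_of_le (fun p => by positivity) (fun p => ?_)
    (h.mul_left (∑ z : (Fin π.N → Bits3) × (Fin π.N → Option (Fin 3)),
      ‖∏ i, amp (o.1 i) (z.1 i) (o.2 i) (z.2 i)‖ ^ 2))
  rw [eveVec_eq]
  refine le_trans ?_ (Finset.sum_mul_sq_le_sq_mul_sq _ _ _)
  gcongr
  refine (norm_sum_le _ _).trans_eq (Finset.sum_congr rfl fun z _ => norm_smul _ _)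

theorem labelProb_eq (y : Fin π.N → BobRec) : π.labelProb y = ∏ i, roundProb π.t (y i) := by
  refine Finset.prod_congr rfl fun i _ => ?_
  rcases y i with _ | ⟨j, d, _ | _⟩ <;> rfl

/-- The single-round amplitudes form an isometry up to the factor `1 / 8` for three uniform bits, so
different bits and different basis states of Bob do not interfere. -/
theorem sum_labelProb_mul_norm_sq (p : π.Env A) :
    ∑ o, π.labelProb o.2 * ‖π.eveVec A keyAmp o p‖ ^ 2
      = ∑ b, (1 / 8) ^ π.N * ∑ q, ‖π.branch A b q p‖ ^ 2 := by
  have h := sum_isometry_norm_sq (O := π.Outcome)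
    (U := fun o (z : (Fin π.N → Bits3) × (Fin π.N → Option (Fin 3))) =>
      ∏ i, keyAmp (o.1 i) (z.1 i) (o.2 i) (z.2 i)) (w := fun o => π.labelProb o.2)
    (c := fun _ => (1 / 8) ^ π.N) (fun z z' => ?_) (fun z => π.branch A z.1 z.2 p)
  · simp only [← eveVec_eq] at h
    rw [h, Fintype.sum_prod_type]
    simp only [Finset.mul_sum]
  · simp only [labelProb_eq, map_prod, Complex.ofReal_prod, ← Finset.prod_mul_distrib]
    rw [sum_prod_outcome fun i a y => (roundProb π.t y : ℂ) * (keyAmp a (z.1 i) y (z.2 i)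
      * (starRingEnd ℂ) (keyAmp a (z'.1 i) y (z'.2 i)))]
    simp only [keyAmp_isometry]
    rw [prod_ite_eq z z']
    simp

theorem tsum_sum_labelProb_mul_norm_sq_le :
    ∑' p : π.Env A, ∑ o, π.labelProb o.2 * ‖π.eveVec A keyAmp o p‖ ^ 2 ≤ 1 := by
  simp only [sum_labelProb_mul_norm_sq]
  rw [Summable.tsum_finsetSum fun b _ => (π.summable_norm_sq_branch A b).mul_left _]
  simp only [tsum_mul_left]
  calc ∑ b : Fin π.N → Bits3, (1 / 8 : ℝ) ^ π.N * ∑' p, ∑ q, ‖π.branch A b q p‖ ^ 2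
      ≤ ∑ b : Fin π.N → Bits3, (1 / 8 : ℝ) ^ π.N * 1 := by
        gcongr with b
        exact π.tsum_norm_sq_branch_le A b
    _ = 1 := by
        simp only [mul_one, Finset.sum_const, Finset.card_univ, Fintype.card_fun, Fintype.card_fin,
          ZMod.card, nsmul_eq_mul]
        push_cast
        rw [← mul_pow]
        norm_num

/-! ## Changes of basis -/

section Mix

variable {u : Bits3 → BobRec → Bits3 → BobRec → ℂ}
  {amp amp' : Bits3 → Bits3 → BobRec → Option (Fin 3) → ℂ}

theorem eveVec_mix (h : ∀ a b y q, amp a b y q = ∑ a', ∑ y', u a y a' y' * amp' a' b y' q)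
    (o : π.Outcome) (p : π.Env A) :
    π.eveVec A amp o p = ∑ o' : π.Outcome,
      (∏ i, u (o.1 i) (o.2 i) (o'.1 i) (o'.2 i)) • π.eveVec A amp' o' p := by
  simp only [eveVec_eq, Finset.smul_sum, smul_smul, ← Finset.prod_mul_distrib]
  rw [Finset.sum_comm]
  refine Finset.sum_congr rfl fun z _ => ?_
  rw [← Finset.sum_smul, sum_prod_outcome fun i a' y' =>
    u (o.1 i) (o.2 i) a' y' * amp' a' (z.1 i) y' (z.2 i)]
  simp only [h]

/-- Orthogonality survives restriction to an event when the mixing only connects outcomes on which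
the event agrees; the indicator can then be evaluated at `z` and pulled out. -/
theorem sum_mix_mul_conj (h : ∀ a y a' y', ∑ x, ∑ v, u x v a y * (starRingEnd ℂ) (u x v a' y')
      = if a = a' ∧ y = y' then 1 else 0)
    (P : π.Outcome → Prop) [DecidablePred P]
    (hP : ∀ o o' : π.Outcome, (∀ i, u (o.1 i) (o.2 i) (o'.1 i) (o'.2 i) ≠ 0) → (P o ↔ P o'))
    (z z' : π.Outcome) :
    ∑ o : π.Outcome, (if P o then 1 else 0 : ℂ) * ((∏ i, u (o.1 i) (o.2 i) (z.1 i) (z.2 i)) *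
      (starRingEnd ℂ) (∏ i, u (o.1 i) (o.2 i) (z'.1 i) (z'.2 i)))
      = if z = z' then (if P z then 1 else 0) else 0 := by
  have h1 : ∀ o : π.Outcome, (if P o then 1 else 0 : ℂ)
        * ((∏ i, u (o.1 i) (o.2 i) (z.1 i) (z.2 i)) *
        (starRingEnd ℂ) (∏ i, u (o.1 i) (o.2 i) (z'.1 i) (z'.2 i)))
      = (if P z then 1 else 0 : ℂ) * ∏ i, u (o.1 i) (o.2 i) (z.1 i) (z.2 i)
        * (starRingEnd ℂ) (u (o.1 i) (o.2 i) (z'.1 i) (z'.2 i)) := fun o => by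
    rw [Finset.prod_mul_distrib, map_prod]
    by_cases h0 : ∀ i, u (o.1 i) (o.2 i) (z.1 i) (z.2 i) ≠ 0
    · simp only [hP o z h0]
    · push Not at h0
      obtain ⟨i, hi⟩ := h0
      rw [Finset.prod_eq_zero (Finset.mem_univ i) hi]
      simp
  rw [Finset.sum_congr rfl fun o _ => h1 o, ← Finset.mul_sum, sum_prod_outcome fun i x v =>
    u x v (z.1 i) (z.2 i) * (starRingEnd ℂ) (u x v (z'.1 i) (z'.2 i))]
  simp only [h]
  rw [prod_ite_eq z z']
  simp

end Mix

theorem pubRec_eq_of_bobMix_ne_zero {y y' : BobRec} (h : bobMix y y' ≠ 0) (a : Bits3) :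
    pubRec a y = pubRec a y' := by
  rcases y with _ | ⟨j, d, _ | _⟩ <;> rcases y' with _ | ⟨j', d', _ | _⟩ <;>
    simp_all [bobMix, pubRec]

/-- The states, for given public data and bits of Alice, are the same if Bob measures the position
of the photon in the code rounds. -/
theorem sum_rankOne_actual (P : Data π.N → (Fin π.N → Bits3) → Prop) [∀ d b, Decidable (P d b)]
    (p : π.Env A) :
    ∑ o with P (π.data o) o.1, InnerProductSpace.rankOne ℂ (π.eveVec A actualAmp o p)
        (π.eveVec A actualAmp o p)
      = ∑ o with P (π.data o) o.1, InnerProductSpace.rankOne ℂ (π.eveVec A keyAmp o p)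
        (π.eveVec A keyAmp o p) := by
  have h := sum_isometry_rankOne (π.sum_mix_mul_conj
    (u := fun a y a' y' => if a = a' then bobMix y y' else 0) (fun a y a' y' => ?_)
    (fun o => P (π.data o) o.1) fun o o' hoo' => ?_) (fun o => π.eveVec A keyAmp o p)
  · simp only [← π.eveVec_mix A actualAmp_eq] at h
    simpa only [Finset.sum_filter, ite_smul, one_smul, zero_smul] using h
  · have h1 : ∀ x v, (if x = a then bobMix v y else 0)
          * (starRingEnd ℂ) (if x = a' then bobMix v y' else 0)
        = if x = a then if a = a' then bobMix v y * (starRingEnd ℂ) (bobMix v y') else 0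
          else 0 := fun x v => by
      by_cases hx : x = a
      · subst hx
        split_ifs <;> simp
      · simp [hx]
    simp only [h1, Finset.sum_ite_irrel, Finset.sum_const_zero, bobMix_orthogonal,
      Finset.sum_ite_eq', Finset.mem_univ, if_true, ite_and]
  · have h1 : o.1 = o'.1 := funext fun i => by
      by_contra h0
      exact hoo' i (if_neg h0)
    have h2 : π.data o = π.data o' := funext fun i => by
      have h3 := hoo' i
      rw [h1, if_pos rfl] at h3
      change pubRec (o.1 i) (o.2 i) = pubRec (o'.1 i) (o'.2 i)
      rw [h1, pubRec_eq_of_bobMix_ne_zero h3]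
    rw [h1, h2]

end Protocol

/-! ## Shifting the sifted key -/

/-- The pulse whose `Z` value decides on a phase error when the photon is found at `s`. -/
def flipPos (j : Fin 2) (s : ZMod 2) : Fin 3 := if s = 0 then j.succ else j.castSucc

/-- The shift of Alice's bits which adds `c` to the sifted bit of a code round. -/
def roundShift (y : BobRec) (c : ZMod 2) : Bits3 :=
  match y with
  | some (j, s, true) => Pi.single (flipPos j s) c
  | _ => 0

/-- The bit indicating a phase error. -/
def roundPattern (a : Bits3) (y : BobRec) : ZMod 2 :=
  match y with
  | some (j, s, true) => a (flipPos j s)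
  | _ => 0

@[simp] theorem roundShift_zero (y : BobRec) : roundShift y 0 = 0 := by
  rcases y with _ | ⟨j, s, _ | _⟩ <;> simp [roundShift]

theorem roundShift_add (y : BobRec) (c c' : ZMod 2) :
    roundShift y (c + c') = roundShift y c + roundShift y c' := by
  rcases y with _ | ⟨j, s, _ | _⟩ <;> simp [roundShift, Pi.single_add]

/-- Only code rounds are shifted, and there nothing about Alice's bits is announced. -/
theorem pubRec_add_roundShift (a : Bits3) (y : BobRec) (c : ZMod 2) :
    pubRec (a + roundShift y c) y = pubRec a y := by
  rcases y with _ | ⟨j, s, _ | _⟩ <;> simp [roundShift, pubRec]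

theorem diffBit_add_single (a : Bits3) (j : Fin 2) (s c : ZMod 2) :
    diffBit (a + Pi.single (flipPos j s) c) j = diffBit a j + c := by
  have h1 : j.castSucc ≠ j.succ := (Fin.castSucc_lt_succ).ne
  unfold diffBit flipPos
  split_ifs
  · simp [h1, add_assoc]
  · simp [h1.symm, add_right_comm]

/-- A bit flip in the `X` basis is a sign in the `Z` basis, given by the `Z` value of the flipped
pulse. Choosing the pulse without the photon makes this value the phase error bit. -/
theorem aliceMix_add_roundShift (y : BobRec) (a a' : Bits3) (c : ZMod 2) :
    aliceMix y a (a' + roundShift y c) = sgn (roundPattern a y * c) * aliceMix y a a' := by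
  rcases y with _ | ⟨j, s, _ | _⟩
  · simp [aliceMix, roundShift, roundPattern]
  · simp [aliceMix, roundShift, roundPattern]
  · simp only [aliceMix, roundShift, roundPattern, prod_sgn_div]
    rw [dotProduct_add, sgn_add, dotProduct_single]
    ring

theorem phaseError_eq (a : Bits3) (y : BobRec) :
    phaseError a y = decide (roundPattern a y = 1) := by
  rcases y with _ | ⟨j, s, _ | _⟩
  · simp [phaseError, roundPattern]
  · simp [phaseError, roundPattern]
  · simp only [phaseError, roundPattern, flipPos]
    split_ifs <;> rfl

theorem sgn_sum {ι : Type*} (s : Finset ι) (f : ι → ZMod 2) :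
    sgn (∑ i ∈ s, f i) = ∏ i ∈ s, sgn (f i) := by
  classical
  induction s using Finset.induction_on with
  | empty => simp
  | insert i s hi ih => rw [Finset.sum_insert hi, Finset.prod_insert hi, sgn_add, ih]

/-- Extension by zero to all rounds. -/
def extendKey {N : ℕ} {d : Data N} (κ : CodeRounds d → ZMod 2) (i : Fin N) : ZMod 2 :=
  if hi : PubRec.isCode (d i) = true then κ ⟨i, hi⟩ else 0

theorem extendKey_coe {N : ℕ} {d : Data N} (κ : CodeRounds d → ZMod 2) (i : CodeRounds d) :
    extendKey κ i = κ i := dif_pos i.2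

theorem extendKey_zero {N : ℕ} {d : Data N} (i : Fin N) :
    extendKey (0 : CodeRounds d → ZMod 2) i = 0 := by
  unfold extendKey; split_ifs <;> rfl

theorem extendKey_add {N : ℕ} {d : Data N} (κ κ' : CodeRounds d → ZMod 2) (i : Fin N) :
    extendKey (κ + κ') i = extendKey κ i + extendKey κ' i := by
  unfold extendKey; split_ifs <;> simp

theorem sum_codeRounds {N : ℕ} (d : Data N) {V : Type*} [AddCommMonoid V] (F : Fin N → V)
    (hF : ∀ i, PubRec.isCode (d i) ≠ true → F i = 0) : ∑ i, F i = ∑ i : CodeRounds d, F i := by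
  rw [← Finset.sum_subtype (Finset.univ.filter fun i => PubRec.isCode (d i) = true) (by simp) F]
  exact (Finset.sum_filter_of_ne fun i _ hi => by
    by_contra h
    exact hi (hF i h)).symm

namespace Protocol

variable {S R : Type} (π : Protocol S R) (A : Attack S π.N)

/-- The outcomes with public data `d`. -/
abbrev Fiber (d : Data π.N) : Type := {o : π.Outcome // π.data o = d}

/-- The action of the key space on the outcomes with data `d`, adding `κ` to the sifted key. -/
def shift (d : Data π.N) (κ : CodeRounds d → ZMod 2) (o : π.Fiber d) : π.Fiber d :=
  ⟨(fun i => o.1.1 i + roundShift (o.1.2 i) (extendKey κ i), o.1.2),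
    (funext fun _ => pubRec_add_roundShift _ _ _ : _ = π.data o.1).trans o.2⟩

/-- The pattern of phase errors in the code rounds. -/
def pattern (d : Data π.N) (o : π.Fiber d) (i : CodeRounds d) : ZMod 2 :=
  roundPattern (o.1.1 i) (o.1.2 i)

variable {π} {d : Data π.N}

theorem shift_zero (o : π.Fiber d) : π.shift d 0 o = o :=
  Subtype.ext (Prod.ext (funext fun i => by simp [shift, extendKey_zero]) rfl)

theorem shift_add (κ κ' : CodeRounds d → ZMod 2) (o : π.Fiber d) :
    π.shift d (κ + κ') o = π.shift d κ (π.shift d κ' o) :=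
  Subtype.ext (Prod.ext (funext fun i => by
    simp only [shift, extendKey_add, roundShift_add]
    abel) rfl)

theorem exists_codeRound (o : π.Fiber d) (i : CodeRounds d) :
    ∃ j s, o.1.2 i = some (j, s, true) ∧ d i = some (j, none) := by
  have h1 : pubRec (o.1.1 i) (o.1.2 i) = d i := congrFun o.2 i
  have h2 := i.2
  rw [← h1] at h2 ⊢
  rcases h3 : o.1.2 i with _ | ⟨j, s, _ | _⟩ <;> rw [h3] at h2
  · exact (Bool.false_ne_true h2).elim
  · exact (Bool.false_ne_true h2).elim
  · exact ⟨j, s, rfl, rfl⟩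

theorem roundPattern_of_not_isCode (o : π.Fiber d) {i : Fin π.N}
    (hi : PubRec.isCode (d i) ≠ true) : roundPattern (o.1.1 i) (o.1.2 i) = 0 := by
  have h1 : pubRec (o.1.1 i) (o.1.2 i) = d i := congrFun o.2 i
  rw [← h1] at hi
  rcases h : o.1.2 i with _ | ⟨j, s, _ | _⟩
  · rfl
  · rfl
  · rw [h] at hi
    exact (hi rfl).elim

theorem siftedKey_shift (κ : CodeRounds d → ZMod 2) (o : π.Fiber d) :
    siftedKey d (π.shift d κ o).1.1 = siftedKey d o.1.1 + κ := by
  funext i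
  obtain ⟨j, s, h1, h2⟩ := exists_codeRound o i
  simp only [siftedKey, shift, Pi.add_apply, h1, h2, extendKey_coe]
  exact diffBit_add_single _ _ _ _

theorem numPhaseErrors_eq (o : π.Fiber d) :
    numPhaseErrors o.1.1 o.1.2 = (Finset.univ.filter fun i => π.pattern d o i = 1).card := by
  rw [numPhaseErrors, Fintype.card_subtype, Finset.card_filter, Finset.card_filter]
  simp only [phaseError_eq, decide_eq_true_eq]
  exact sum_codeRounds d (fun i => if roundPattern (o.1.1 i) (o.1.2 i) = 1 then 1 else 0)
    fun i hi => by rw [roundPattern_of_not_isCode o hi]; simp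

variable (π) in
/-- The change of basis from `keyAmp` to `virtualAmp`. -/
def virtualMix (o o' : π.Outcome) : ℂ :=
  ∏ i, if o.2 i = o'.2 i then aliceMix (o.2 i) (o.1 i) (o'.1 i) else 0

/-- The virtual basis diagonalises all key translations at once, with the phase error pattern as
character. -/
theorem virtualMix_shift (κ : CodeRounds d → ZMod 2) (o o' : π.Fiber d) :
    π.virtualMix o.1 (π.shift d κ o').1
      = sgn (π.pattern d o ⬝ᵥ κ) * π.virtualMix o.1 o'.1 := by
  have h1 : π.pattern d o ⬝ᵥ κ
      = ∑ i, roundPattern (o.1.1 i) (o.1.2 i) * extendKey κ i := by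
    rw [sum_codeRounds d _ fun i hi => by rw [roundPattern_of_not_isCode o hi, zero_mul]]
    simp only [extendKey_coe]
    rfl
  rw [h1, sgn_sum, virtualMix, virtualMix, ← Finset.prod_mul_distrib]
  refine Finset.prod_congr rfl fun i _ => ?_
  change (if o.1.2 i = o'.1.2 i then aliceMix (o.1.2 i) (o.1.1 i)
    (o'.1.1 i + roundShift (o'.1.2 i) (extendKey κ i)) else 0) = _
  split_ifs with h
  · rw [← h, aliceMix_add_roundShift]
  · simp

theorem data_eq_of_virtualMix {o o' : π.Outcome}
    (h : ∀ i, (if o.2 i = o'.2 i then aliceMix (o.2 i) (o.1 i) (o'.1 i) else 0) ≠ 0) :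
    π.data o = π.data o' := funext fun i => by
  have h1 := h i
  split_ifs at h1 with h2
  · change pubRec (o.1 i) (o.2 i) = pubRec (o'.1 i) (o'.2 i)
    rw [← h2]
    rcases h3 : o.2 i with _ | ⟨j, s, _ | _⟩
    · rfl
    · rw [h3] at h1
      have h4 : o.1 i = o'.1 i := by
        by_contra h4
        exact h1 (if_neg h4)
      rw [h4]
    · rfl
  · exact (h1 rfl).elim

theorem sum_virtualMix_mul_conj (z z' : π.Fiber d) :
    ∑ o : π.Fiber d, π.virtualMix o.1 z.1 * (starRingEnd ℂ) (π.virtualMix o.1 z'.1)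
      = if z = z' then 1 else 0 := by
  have h := π.sum_mix_mul_conj
    (u := fun a y a' y' => if y = y' then aliceMix y a a' else 0) (fun a y a' y' => ?_)
    (fun o => π.data o = d) (fun o o' hoo' => by rw [data_eq_of_virtualMix hoo']) z.1 z'.1
  · rw [if_pos z.2] at h
    simp only [ite_mul, one_mul, zero_mul] at h
    rw [← Finset.sum_filter, Finset.sum_subtype (p := fun o => π.data o = d) _ (by simp)] at h
    simp only [Subtype.ext_iff]
    exact h
  · have h1 : ∀ x v, (if v = y then aliceMix v x a else 0)
          * (starRingEnd ℂ) (if v = y' then aliceMix v x a' else 0)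
        = if v = y then if y = y' then aliceMix y x a * (starRingEnd ℂ) (aliceMix y x a') else 0
          else 0 := fun x v => by
      by_cases hv : v = y
      · subst hv
        split_ifs <;> simp
      · simp [hv]
    simp only [h1, Finset.sum_ite_irrel, Finset.sum_const_zero, aliceMix_orthogonal,
      Finset.sum_ite_eq', Finset.mem_univ, if_true, and_comm (a := a = a'), ite_and]

theorem eveVec_virtual (o : π.Fiber d) (p : π.Env A) :
    π.eveVec A virtualAmp o.1 p
      = ∑ o' : π.Fiber d, π.virtualMix o.1 o'.1 • π.eveVec A keyAmp o'.1 p := by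
  rw [π.eveVec_mix A virtualAmp_eq, ← Finset.sum_subtype (Finset.univ.filter fun o => π.data o = d)
    (by simp) fun o' => π.virtualMix o.1 o' • π.eveVec A keyAmp o' p]
  refine (Finset.sum_filter_of_ne fun o' _ ho' => ?_).symm
  by_contra h
  refine ho' ?_
  have : π.virtualMix o.1 o' = 0 := by
    by_contra h0
    exact h ((data_eq_of_virtualMix fun i => Finset.prod_ne_zero_iff.1 h0 i
      (Finset.mem_univ i)).symm.trans o.2)
  exact smul_eq_zero_of_left this _

/-- The weight of the phase error pattern `x` in the virtual protocol. -/
theorem sum_norm_sq_virtual (x : CodeRounds d → ZMod 2) (p : π.Env A) :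
    ∑ o : π.Fiber d with π.pattern d o = x, ‖π.eveVec A virtualAmp o.1 p‖ ^ 2
      = ∑ o : π.Fiber d, ‖charAvg (π.shift d) Finset.univ
        (fun o => π.eveVec A keyAmp o.1 p) x o‖ ^ 2 := by
  classical
  have h := sum_isometry_norm_sq (O := π.Fiber d) (U := fun o o' => π.virtualMix o.1 o'.1)
    (w := fun _ => 1) (c := fun _ => 1) (fun z z' => by
      simp only [Complex.ofReal_one, one_mul]
      convert sum_virtualMix_mul_conj z z')
    (charAvg (π.shift d) Finset.univ (fun o => π.eveVec A keyAmp o.1 p) x)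
  simp only [one_mul] at h
  rw [← h, Finset.sum_filter]
  refine Finset.sum_congr rfl fun o _ => ?_
  have h1 : ∀ κ, ∑ o' : π.Fiber d, π.virtualMix o.1 o'.1 •
      π.eveVec A keyAmp (π.shift d κ o').1 p
      = sgn (π.pattern d o ⬝ᵥ κ) • π.eveVec A virtualAmp o.1 p := fun κ => by
    rw [← sum_action shift_zero shift_add κ, eveVec_virtual, Finset.smul_sum]
    refine Finset.sum_congr rfl fun o' _ => ?_
    rw [action_involutive shift_zero shift_add κ o', virtualMix_shift, mul_smul]
  -- In the virtual basis the twisted average is the projection onto pattern `x`: the sum over `κ`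
  -- leaves only outcomes whose pattern is `x`.
  have h2 : ∑ z : π.Fiber d, π.virtualMix o.1 z.1 • charAvg (π.shift d) Finset.univ
      (fun o => π.eveVec A keyAmp o.1 p) x z
      = if π.pattern d o = x then π.eveVec A virtualAmp o.1 p else 0 := by
    simp only [charAvg, Finset.smul_sum]
    rw [Finset.sum_comm]
    have h3 : ∀ κ, ∑ z : π.Fiber d, π.virtualMix o.1 z.1 •
        ((Finset.univ : Finset (CodeRounds d → ZMod 2)).card : ℂ)⁻¹ •
          sgn (x ⬝ᵥ κ) • π.eveVec A keyAmp (π.shift d κ z).1 p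
        = (((Finset.univ : Finset (CodeRounds d → ZMod 2)).card : ℂ)⁻¹ *
          sgn (κ ⬝ᵥ (x + π.pattern d o))) • π.eveVec A virtualAmp o.1 p := fun κ => by
      rw [dotProduct_comm κ, add_dotProduct, sgn_add, ← mul_assoc, mul_smul, ← h1,
        Finset.smul_sum]
      refine Finset.sum_congr rfl fun z _ => ?_
      simp only [smul_smul]
      congr 1
      ring
    rw [Finset.sum_congr rfl fun κ _ => h3 κ, ← Finset.sum_smul, ← Finset.mul_sum,
      sum_sgn_dotProduct]
    simp only [zmod_two_add_eq_zero, eq_comm (a := x)]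
    split_ifs
    · simp [Finset.card_univ]
    · simp
  rw [h2]
  split_ifs <;> simp

end Protocol

/-! ## The deviation from an ideal key as a linear map -/

theorem embed_trans {X Y Z : Type} (f : X ↪ Y) (g : Y ↪ Z) (v : L2 X) :
    embed (f.trans g) v = embed g (embed f v) := by
  refine lp.ext (funext fun z => ?_)
  by_cases hz : ∃ y, g y = z
  · obtain ⟨y, rfl⟩ := hz
    rw [embed_apply]
    by_cases hy : ∃ x, f x = y
    · obtain ⟨x, rfl⟩ := hy
      rw [embed_apply]
      exact embed_apply (f.trans g) v x
    · rw [embed_apply_of_notMem f v hy, embed_apply_of_notMem]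
      rintro ⟨x, hx⟩
      exact hy ⟨x, g.injective hx⟩
  · rw [embed_apply_of_notMem g _ hz, embed_apply_of_notMem]
    rintro ⟨x, hx⟩
    exact hz ⟨f x, hx⟩

theorem rankOne_embed {X Y : Type} (f : X ↪ Y) (v : L2 X) :
    InnerProductSpace.rankOne ℂ (embed f v) (embed f v)
      = conjEmbed f (InnerProductSpace.rankOne ℂ v v) := by
  ext1 u
  simp only [conjEmbed, ContinuousLinearMap.comp_apply, InnerProductSpace.rankOne_apply, map_smul,
    ContinuousLinearMap.adjoint_inner_right]
  rfl

theorem conjEmbed_sum {ι : Type*} {X Y : Type} (f : X ↪ Y) (s : Finset ι)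
    (A : ι → L2 X →L[ℂ] L2 X) : conjEmbed f (∑ i ∈ s, A i) = ∑ i ∈ s, conjEmbed f (A i) := by
  ext1 u
  simp [conjEmbed]

theorem conjEmbed_sub {X Y : Type} (f : X ↪ Y) (A B : L2 X →L[ℂ] L2 X) :
    conjEmbed f (A - B) = conjEmbed f A - conjEmbed f B := by
  ext1 u
  simp [conjEmbed]

theorem conjEmbed_smul {X Y : Type} (f : X ↪ Y) (c : ℂ) (A : L2 X →L[ℂ] L2 X) :
    conjEmbed f (c • A) = c • conjEmbed f A := by
  ext1 u
  simp [conjEmbed]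

theorem conjEmbed_trans {X Y Z : Type} (f : X ↪ Y) (g : Y ↪ Z) (A : L2 X →L[ℂ] L2 X) :
    conjEmbed (f.trans g) A = conjEmbed g (conjEmbed f A) := by
  have h1 : (embed (f.trans g)).toContinuousLinearMap
      = (embed g).toContinuousLinearMap ∘L (embed f).toContinuousLinearMap :=
    ContinuousLinearMap.ext fun v => embed_trans f g v
  unfold conjEmbed
  rw [h1, ContinuousLinearMap.adjoint_comp]
  rfl

section Defect

variable {K X : Type} [Fintype K]

omit [Fintype K] in
theorem adjoint_inr_inr_same (k : K) (v : L2 X) :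
    ContinuousLinearMap.adjoint (embed (inr (X := X) k)).toContinuousLinearMap
      (embed (inr k) v) = v := by
  refine lp.ext (funext fun x => ?_)
  rw [adjoint_embed_apply, embed_apply]

omit [Fintype K] in
theorem adjoint_inr_inr_of_ne {k k' : K} (hk : k ≠ k') (v : L2 X) :
    ContinuousLinearMap.adjoint (embed (inr (X := X) k)).toContinuousLinearMap
      (embed (inr k') v) = 0 := by
  refine lp.ext (funext fun x => ?_)
  rw [adjoint_embed_apply, embed_apply_of_notMem]
  · rfl
  · rintro ⟨y, hy⟩
    exact hk (congrArg Prod.fst hy).symm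

theorem traceFst_ketBra (k : K) (B : L2 X →L[ℂ] L2 X) : traceFst (ketBra k B) = B := by
  ext1 u
  simp only [traceFst, ketBra, sum_apply, ContinuousLinearMap.comp_apply]
  rw [Finset.sum_eq_single k]
  · change ContinuousLinearMap.adjoint (embed (inr (X := X) k)).toContinuousLinearMap
      (embed (inr k) (B (ContinuousLinearMap.adjoint
        (embed (inr (X := X) k)).toContinuousLinearMap (embed (inr k) u)))) = B u
    rw [adjoint_inr_inr_same, adjoint_inr_inr_same]
  · intro k' _ hk
    exact adjoint_inr_inr_of_ne hk _
  · simp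

variable (K X) in
/-- The map `A ↦ A - c ∑ₖ |k⟩⟨k| ⊗ tr₁ A`. -/
def secrecyDefect (c : ℂ) :
    (L2 (K × X) →L[ℂ] L2 (K × X)) →ₗ[ℂ] (L2 (K × X) →L[ℂ] L2 (K × X)) where
  toFun A := A - c • ∑ k, ketBra k (traceFst A)
  map_add' A B := by
    ext1 u
    simp only [traceFst, ketBra, sum_apply, ContinuousLinearMap.comp_apply, map_add, map_sum,
      add_apply, sub_apply, smul_apply, Finset.sum_add_distrib, smul_add]
    abel
  map_smul' a A := by
    ext1 u
    simp only [traceFst, ketBra, sum_apply, ContinuousLinearMap.comp_apply, map_smul, map_sum,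
      sub_apply, smul_apply, ← Finset.smul_sum, smul_sub, RingHom.id_apply]
    rw [smul_comm]

theorem continuous_secrecyDefect (c : ℂ) : Continuous (secrecyDefect K X c) := by
  change Continuous fun A : L2 (K × X) →L[ℂ] L2 (K × X) => A - c • ∑ k, ketBra k (traceFst A)
  unfold ketBra traceFst
  fun_prop

/-- For a classical key the comparison with the ideal state reduces to one operator of Eve per key
value. -/
theorem secrecyDefect_sum_ketBra (c : ℂ) (B : K → L2 X →L[ℂ] L2 X) :
    secrecyDefect K X c (∑ k, ketBra k (B k)) = ∑ k, ketBra k (B k - c • ∑ k', B k') := by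
  have h1 : ∀ k, secrecyDefect K X c (ketBra k (B k))
      = ketBra k (B k) - c • ∑ k', ketBra k' (B k) := fun k => by
    change _ - c • ∑ k', ketBra k' (traceFst (ketBra k (B k))) = _
    rw [traceFst_ketBra]
  rw [map_sum, Finset.sum_congr rfl fun k _ => h1 k, Finset.sum_sub_distrib, ← Finset.smul_sum,
    Finset.sum_comm]
  ext1 u
  simp only [ketBra, sum_apply, ContinuousLinearMap.comp_apply, map_smul, map_sum, map_sub,
      sub_apply, smul_apply, ← Finset.smul_sum, Finset.sum_sub_distrib]

end Defect

/-! ## The length of the final key -/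

theorem NucBound.sub_sum_fin_zero {X : Type} (F : (Fin 0 → ZMod 2) → L2 X →L[ℂ] L2 X)
    (k : Fin 0 → ZMod 2) : NucBound (F k - ((1 / 2 ^ 0 : ℝ) : ℂ) • ∑ k', F k') 0 := by
  have h0 : F k - ((1 / 2 ^ 0 : ℝ) : ℂ) • ∑ k', F k' = 0 := by
    rw [Fintype.sum_subsingleton F k]
    simp
  rw [h0]
  exact NucBound.zero

/-- The length of the final key is small enough for the number of likely patterns. -/
theorem card_mul_pow_le {ι : Type*} [Fintype ι] [DecidableEq ι] {m : ℕ} (hm : m ≠ 0) {ζ : ℝ}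
    (hζ : 0 < ζ) (B : ℝ≥0)
    (hmn : (m : ℝ) ≤ Fintype.card ι - (Fintype.card ι * h (B / Fintype.card ι) + ζ)) :
    ((Finset.univ.filter fun x : ι → ZMod 2 =>
      ((Finset.univ.filter fun i => x i = 1).card : ℝ) ≤ B).card : ℝ) * 2 ^ m
        / 2 ^ Fintype.card ι ≤ 2 ^ (-ζ) := by
  set n := Fintype.card ι with hn
  have hm1 : (1 : ℝ) ≤ m := by exact_mod_cast Nat.one_le_iff_ne_zero.2 hm
  have hn0 : (n : ℝ) ≠ 0 := fun h0 => by
    rw [h0] at hmn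
    linarith
  -- Beyond `1 / 2` the function `h` is `1`, and no key of positive length would be left.
  have hs : (B / n : ℝ) ≤ 1 / 2 := by
    by_contra hs
    rw [h, if_neg hs] at hmn
    linarith
  have h1 := card_hammingBall_le (ι := ι) (s := B / n) (by positivity) hs
  rw [← hn, div_mul_cancel₀ _ hn0] at h1
  refine (div_le_div_of_nonneg_right (mul_le_mul_of_nonneg_right h1 (by positivity))
    (by positivity)).trans ?_
  rw [← Real.rpow_natCast, ← Real.rpow_natCast, ← Real.rpow_add two_pos, ← Real.rpow_sub two_pos]
  exact Real.rpow_le_rpow_of_exponent_le one_le_two (by linarith)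

/-! ### The deviation for fixed public data and a fixed environment vector. -/

namespace Protocol

variable {S R : Type} {π : Protocol S R} (A : Attack S π.N)

/-- The contribution of the data `d` and the environment state `p` to the probability that the
number of phase errors exceeds `B`, up to the probability of the choice of code rounds. -/
def badWeight (d : Data π.N) (B : ℝ≥0) (p : π.Env A) : ℝ :=
  ∑ o : π.Fiber d with (B : ℝ) < numPhaseErrors o.1.1 o.1.2, ‖π.eveVec A virtualAmp o.1 p‖ ^ 2

/-- The contribution of the data `d` and the environment state `p` to the total probability, up to
the probability of the choice of code rounds. -/
def weight (d : Data π.N) (p : π.Env A) : ℝ :=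
  ∑ o : π.Fiber d, ‖π.eveVec A keyAmp o.1 p‖ ^ 2

/-- The unnormalized state of Eve for the data `d`, the final key `k` and the environment state
`p`. -/
def eveState {m : ℕ} (d : Data π.N) (p : π.Env A) (M : PAMatrix m d) (k : Fin m → ZMod 2) :
    L2 A.E →L[ℂ] L2 A.E :=
  keyState M.1 (fun o : π.Fiber d => siftedKey d o.1.1) (fun o => π.eveVec A keyAmp o.1 p) k

/-- The weight of a character is that of the corresponding phase error pattern, and leaving the ball
means having more than `B` phase errors. -/
theorem sum_charAvg_notMem (d : Data π.N) (B : ℝ≥0) (p : π.Env A) :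
    ∑ x : CodeRounds d → ZMod 2 with x ∉ Finset.univ.filter (fun x =>
      ((Finset.univ.filter fun i => x i = 1).card : ℝ) ≤ B),
      ∑ o, ‖charAvg (π.shift d) Finset.univ (fun o => π.eveVec A keyAmp o.1 p) x o‖ ^ 2
      = badWeight A d B p := by
  rw [badWeight]
  simp only [← sum_norm_sq_virtual, numPhaseErrors_eq]
  rw [← Finset.sum_fiberwise (s := Finset.univ.filter fun o : π.Fiber d =>
    (B : ℝ) < ((Finset.univ.filter fun i => π.pattern d o i = 1).card : ℕ)) (g := π.pattern d),
    Finset.sum_filter]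
  refine Finset.sum_congr rfl fun x _ => ?_
  simp only [Finset.mem_filter, Finset.mem_univ, true_and, not_le]
  split_ifs with hx
  · rw [Finset.filter_filter]
    refine Finset.sum_congr (Finset.filter_congr fun o _ => ?_) fun _ _ => rfl
    exact ⟨fun ho => ⟨by rw [ho]; exact hx, ho⟩, fun ho => ho.2⟩
  · rw [Finset.filter_filter, Finset.filter_false_of_mem, Finset.sum_empty]
    rintro o - ⟨ho, rfl⟩
    exact hx ho

theorem natCast_le_of_keyLength_eq {d : Data π.N} {m : ℕ} (hm : π.keyLength d = m) (hm0 : m ≠ 0) :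
    (m : ℝ) ≤ numCode d - π.NPA d :=
  (Nat.le_floor_iff' hm0).1 hm.ge

theorem exists_nucBound_eveState (d : Data π.N) (B : ℝ≥0) {ζ : ℝ} (hζ : 0 < ζ)
    (hPA : π.NPA d = numCode d * h (B / numCode d) + ζ) (p : π.Env A) {m : ℕ}
    (hm : π.keyLength d = m) {α : ℝ} (hα : 0 < α) :
    ∃ c : PAMatrix m d → (Fin m → ZMod 2) → ℝ,
      (∀ M k, NucBound (eveState A d p M k
        - ((1 / 2 ^ m : ℝ) : ℂ) • ∑ k', eveState A d p M k') (c M k)) ∧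
      ∑ M, ∑ k, c M k ≤ Fintype.card (PAMatrix m d) *
        (α * badWeight A d B p + (α * 2 ^ (-ζ) + 2 / α) * weight A d p) := by
  have hW : 0 ≤ weight A d p := Finset.sum_nonneg fun o _ => by positivity
  have hB : 0 ≤ badWeight A d B p := Finset.sum_nonneg fun o _ => by positivity
  -- The natural floor truncates at zero, so `m = 0` gives no bound on the privacy amplification. An
  -- empty key does not deviate from the ideal one.
  rcases eq_or_ne m 0 with rfl | hm0
  · refine ⟨fun _ _ => 0, fun M k => ?_, ?_⟩
    · exact NucBound.sub_sum_fin_zero (eveState A d p M) k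
    · simp only [Finset.sum_const_zero]
      exact mul_nonneg (Nat.cast_nonneg _)
        (add_nonneg (mul_nonneg hα.le hB) (mul_nonneg (by positivity) hW))
  have hmn : (m : ℝ) ≤ Fintype.card (CodeRounds d)
      - (Fintype.card (CodeRounds d) * h (B / Fintype.card (CodeRounds d)) + ζ) := by
    have h0 := natCast_le_of_keyLength_eq hm hm0
    rwa [hPA] at h0
  set G := Finset.univ.filter fun x : CodeRounds d → ZMod 2 =>
      ((Finset.univ.filter fun i => x i = 1).card : ℝ) ≤ B with hG
  have hcard := card_mul_pow_le hm0 hζ B hmn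
  rw [← hG] at hcard
  choose Rep hRep hRG using fun M : PAMatrix m d => exists_isTransversal M.2 G
  choose c hc hsum using fun M : PAMatrix m d => exists_nucBound_keyState_sub shift_zero shift_add
    (key := fun o : π.Fiber d => siftedKey d o.1.1) siftedKey_shift M.2 (hRep M) (fun o : π.Fiber d => π.eveVec A keyAmp o.1 p) hα
  refine ⟨c, hc, (Finset.sum_le_sum fun M _ => hsum M).trans ?_⟩
  have h1 := sum_sum_notMem_le G Rep hRG (Q := fun x => ∑ o, ‖charAvg (π.shift d) Finset.univ
    (fun o => π.eveVec A keyAmp o.1 p) x o‖ ^ 2) fun x => Finset.sum_nonneg fun o _ => by positivity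
  rw [hG, sum_charAvg_notMem, ← hG, sum_norm_sq_charAvg shift_zero shift_add] at h1
  rw [Finset.sum_add_distrib, ← Finset.mul_sum, Finset.sum_const, nsmul_eq_mul]
  have h2 : (2 : ℝ) ^ Fintype.card (CodeRounds d)
      / (Finset.univ : Finset (CodeRounds d → ZMod 2)).card = 1 := by
    simp [Finset.card_univ]
  rw [h2, one_mul] at h1
  change _ ≤ (Fintype.card (PAMatrix m d) : ℝ) * (badWeight A d B p
    + G.card * 2 ^ m / 2 ^ Fintype.card (CodeRounds d) * weight A d p) at h1
  have h3 := mul_le_mul_of_nonneg_right hcard hW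
  have hP : (0 : ℝ) ≤ Fintype.card (PAMatrix m d) := Nat.cast_nonneg _
  change _ + (Finset.univ.card : ℝ) * (2 / α * weight A d p) ≤ _
  rw [Finset.card_univ]
  have h4 := mul_le_mul_of_nonneg_left (h1.trans (mul_le_mul_of_nonneg_left
    (add_le_add_right h3 _) hP)) hα.le
  linarith

end Protocol

/-! ### Summation over transcripts, environment vectors and key lengths. -/

namespace Protocol

variable {S R : Type} (π : Protocol S R) (A : Attack S π.N)

/-- The probability of the choice of code rounds in the data `d`, given the detected rounds. -/
def dataProb (d : Data π.N) : ℝ :=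
  ∏ i, match d i with
    | none => 1
    | some (_, none) => π.t
    | some (_, some _) => 1 - π.t

theorem dataProb_nonneg (d : Data π.N) : 0 ≤ π.dataProb d := by
  refine Finset.prod_nonneg fun i _ => ?_
  have := π.t_pos
  have := π.t_lt_one
  split <;> linarith

variable {π}

theorem labelProb_eq_dataProb (o : π.Outcome) : π.labelProb o.2 = π.dataProb (π.data o) := by
  refine Finset.prod_congr rfl fun i _ => ?_
  simp only [data, pubData]
  rcases o.2 i with _ | ⟨j, s, _ | _⟩ <;> rfl

theorem sum_fiber {V : Type*} [AddCommMonoid V] (F : Data π.N → π.Outcome → V) :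
    ∑ d, ∑ o : π.Fiber d, F d o.1 = ∑ o, F (π.data o) o := by
  rw [← Finset.sum_fiberwise (s := Finset.univ) (g := π.data)]
  refine Finset.sum_congr rfl fun d _ => ?_
  rw [← Finset.sum_subtype (Finset.univ.filter fun o => π.data o = d) (by simp) (F d)]
  exact Finset.sum_congr rfl fun o ho => by rw [(Finset.mem_filter.1 ho).2]

/-- The hashed key depends only on the public data and Alice's bits, so Bob's unannounced
measurement may be exchanged for the position measurement. -/
theorem sum_keyState_actual (d : Data π.N) {m : ℕ} (M : PAMatrix m d) (k : Fin m → ZMod 2)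
    (p : π.Env A) :
    ∑ o : π.Fiber d with M.1.mulVec (siftedKey d o.1.1) = k,
      InnerProductSpace.rankOne ℂ (π.eveVec A actualAmp o.1 p) (π.eveVec A actualAmp o.1 p)
      = eveState A d p M k := by
  classical
  have h := π.sum_rankOne_actual A (fun d' b => d' = d ∧ M.1.mulVec (siftedKey d b) = k) p
  have h1 : ∀ F : π.Outcome → L2 A.E →L[ℂ] L2 A.E,
      ∑ o : π.Fiber d with M.1.mulVec (siftedKey d o.1.1) = k, F o.1
        = ∑ o with π.data o = d ∧ M.1.mulVec (siftedKey d o.1) = k, F o := fun F => by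
    rw [← Finset.filter_filter, Finset.sum_filter, Finset.sum_filter,
      ← Finset.sum_subtype (Finset.univ.filter fun o => π.data o = d) (by simp)
        fun o : π.Outcome => if M.1.mulVec (siftedKey d o.1) = k then F o else 0]
  rw [h1 fun o => InnerProductSpace.rankOne ℂ (π.eveVec A actualAmp o p)
    (π.eveVec A actualAmp o p), eveState, keyState,
    h1 fun o => InnerProductSpace.rankOne ℂ (π.eveVec A keyAmp o p) (π.eveVec A keyAmp o p)]
  convert h

open Classical in
/-- The contribution of the environment state `p` to `finalStateSub`. -/
def finalStateTerm (n : ℕ) (p : π.Env A) : L2 (π.KeyEve A n) →L[ℂ] L2 (π.KeyEve A n) :=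
  ∑ d : {d : Data π.N // π.keyLength d = n},
    ∑ o : π.Outcome, if π.data o = d.1 then
      ∑ c : Fin (π.NEC d) → ZMod 2, ∑ seed : π.Seed, ∑ c' : Fin π.ζ' → ZMod 2,
      ∑ M : PAMatrix n d.1,
        ((π.labelProb o.2 / (2 ^ π.NEC d * Fintype.card π.Seed * 2 ^ π.ζ' *
          Fintype.card (PAMatrix n d.1)) : ℝ) : ℂ) •
          let κ := siftedKey d.1 o.1
          let v := embed (π.keyEve A (M.1.mulVec κ)
            ⟨d, π.syndrome d κ + c, seed, π.tag d seed κ + c', M⟩) (π.eveVec A actualAmp o p)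
          InnerProductSpace.rankOne ℂ v v
    else 0

theorem hasSum_finalStateTerm (n : ℕ) :
    HasSum (finalStateTerm A n) (π.finalStateSub A n) := by
  unfold finalStateTerm finalStateSub
  refine hasSum_sum fun d _ => hasSum_sum fun o _ => ?_
  split_ifs
  · refine hasSum_sum fun c _ => hasSum_sum fun seed _ => hasSum_sum fun c' _ =>
      hasSum_sum fun M _ => HasSum.const_smul _ (Summable.hasSum (Summable.of_norm ?_))
    refine (π.summable_norm_sq_eveVec A actualAmp o).congr fun p => ?_
    simp only [InnerProductSpace.norm_rankOne, LinearIsometry.norm_map, sq]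
  · exact hasSum_zero

theorem conjEmbed_keyEve {n : ℕ} (k : Fin n → ZMod 2) (τ : π.Transcript n)
    (B : L2 A.E →L[ℂ] L2 A.E) :
    conjEmbed (π.keyEve A k τ) B = ketBra k (conjEmbed (inr τ) B) :=
  conjEmbed_trans (inr τ) (inr k) B

/-- One-time pad: a key-dependent offset of a uniform string only permutes its values, hence
disappears in the sum. -/
theorem sum_sum_pad {O C D M Sd V : Type*} [Fintype O] [Fintype C] [AddGroup C] [Fintype D]
    [AddGroup D] [Fintype M] [Fintype Sd] [AddCommGroup V] [Module ℂ V] (a : ℂ) (x : O → C)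
    (y : O → Sd → D) (G : O → C → Sd → D → M → V) :
    ∑ o, ∑ c, ∑ s, ∑ c', ∑ M, a • G o (x o + c) s (y o s + c') M
      = a • ∑ c, ∑ s, ∑ c', ∑ M, ∑ o, G o c s c' M := by
  have h1 : ∀ o, ∑ c, ∑ s, ∑ c', ∑ M, G o (x o + c) s (y o s + c') M
      = ∑ c, ∑ s, ∑ c', ∑ M, G o c s c' M := fun o => by
    refine (Equiv.sum_comp (Equiv.addLeft (x o))
      fun c => ∑ s, ∑ c', ∑ M, G o c s (y o s + c') M).trans ?_
    refine Finset.sum_congr rfl fun c _ => Finset.sum_congr rfl fun s _ => ?_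
    exact Equiv.sum_comp (Equiv.addLeft (y o s)) fun c' => ∑ M, G o c s c' M
  simp only [← Finset.smul_sum, h1]
  congr 1
  rw [Finset.sum_comm]
  refine Finset.sum_congr rfl fun c _ => ?_
  rw [Finset.sum_comm]
  refine Finset.sum_congr rfl fun seed _ => ?_
  rw [Finset.sum_comm]
  exact Finset.sum_congr rfl fun c' _ => Finset.sum_comm

open Classical in
theorem finalStateTerm_eq (n : ℕ) (p : π.Env A) :
    finalStateTerm A n p = ∑ d : {d : Data π.N // π.keyLength d = n},
      ((π.dataProb d.1 / (2 ^ π.NEC d * Fintype.card π.Seed * 2 ^ π.ζ' *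
          Fintype.card (PAMatrix n d.1)) : ℝ) : ℂ) •
      ∑ c : Fin (π.NEC d) → ZMod 2, ∑ seed : π.Seed, ∑ c' : Fin π.ζ' → ZMod 2,
      ∑ M : PAMatrix n d.1, ∑ k : Fin n → ZMod 2,
        ketBra k (conjEmbed (inr (⟨d, c, seed, c', M⟩ : π.Transcript n))
          (eveState A d.1 p M k)) := by
  refine Finset.sum_congr rfl fun d _ => ?_
  have h1 : ∀ (c : Fin (π.NEC d) → ZMod 2) (seed : π.Seed) (c' : Fin π.ζ' → ZMod 2)
      (M : PAMatrix n d.1), ∑ k : Fin n → ZMod 2,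
        ketBra k (conjEmbed (inr (⟨d, c, seed, c', M⟩ : π.Transcript n)) (eveState A d.1 p M k))
      = ∑ o : π.Fiber d.1, conjEmbed (π.keyEve A (M.1.mulVec (siftedKey d.1 o.1.1))
          ⟨d, c, seed, c', M⟩) (InnerProductSpace.rankOne ℂ (π.eveVec A actualAmp o.1 p)
            (π.eveVec A actualAmp o.1 p)) := fun c seed c' M => by
    rw [← Finset.sum_fiberwise (s := Finset.univ)
      (g := fun o : π.Fiber d.1 => M.1.mulVec (siftedKey d.1 o.1.1))]
    refine Finset.sum_congr rfl fun k _ => ?_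
    rw [← conjEmbed_keyEve, ← sum_keyState_actual, conjEmbed_sum]
    exact Finset.sum_congr rfl fun o ho => by rw [(Finset.mem_filter.1 ho).2]
  simp only [h1]
  rw [← Finset.sum_filter, Finset.sum_subtype (p := fun o => π.data o = d.1) _ (by simp)]
  simp only [rankOne_embed]
  refine (Finset.sum_congr rfl fun o _ => ?_).trans (sum_sum_pad (O := π.Fiber d.1)
    ((π.dataProb d.1 / (2 ^ π.NEC d * Fintype.card π.Seed * 2 ^ π.ζ' *
      Fintype.card (PAMatrix n d.1)) : ℝ) : ℂ)
    (fun o => π.syndrome d (siftedKey d.1 o.1.1)) (fun o seed => π.tag d seed (siftedKey d.1 o.1.1))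
    fun o c seed c' M => conjEmbed (π.keyEve A (M.1.mulVec (siftedKey d.1 o.1.1))
      ⟨d, c, seed, c', M⟩) (InnerProductSpace.rankOne ℂ (π.eveVec A actualAmp o.1 p)
        (π.eveVec A actualAmp o.1 p)))
  rw [labelProb_eq_dataProb, o.2]

/-- The bound on the deviation from an ideal key, for the data `d` and environment state `p`. -/
def defectBound (B : ℝ≥0) (α ζ : ℝ) (d : Data π.N) (p : π.Env A) : ℝ :=
  π.dataProb d * (α * badWeight A d B p + (α * 2 ^ (-ζ) + 2 / α) * weight A d p)

theorem defectBound_nonneg (B : ℝ≥0) {α : ℝ} (hα : 0 < α) (ζ : ℝ) (d : Data π.N) (p : π.Env A) :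
    0 ≤ defectBound A B α ζ d p := by
  have hW : 0 ≤ weight A d p := Finset.sum_nonneg fun o _ => by positivity
  have hB : 0 ≤ badWeight A d B p := Finset.sum_nonneg fun o _ => by positivity
  exact mul_nonneg (π.dataProb_nonneg d)
    (add_nonneg (mul_nonneg hα.le hB) (mul_nonneg (by positivity) hW))

theorem div_mul_sum_le {s e t P x X : ℝ} (hs : 0 < s) (he : 0 < e) (ht : 0 < t) {a : ℝ}
    (ha : 0 ≤ a) (hP : 0 ≤ P) (hX : 0 ≤ X) (hx : x ≤ P * X) :
    a / (s * e * t * P) * (s * (e * (t * x))) ≤ a * X := by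
  -- Without any full-rank matrix the division by zero gives zero, and the bound is trivial.
  rcases hP.eq_or_lt with rfl | hP
  · simp only [mul_zero, div_zero, zero_mul]
    positivity
  · have h1 : a / (s * e * t * P) * (s * (e * (t * x))) = a * (x / P) := by field_simp
    rw [h1]
    exact mul_le_mul_of_nonneg_left ((div_le_iff₀' hP).2 hx) ha

theorem nucBound_secrecyDefect_term (NU : Data π.N → ℝ≥0) {ζ : ℝ} (hζ : 0 < ζ)
    (hPA : ∀ d, π.NPA d = numCode d * h (NU d / numCode d) + ζ) {α : ℝ} (hα : 0 < α) (n : ℕ)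
    (p : π.Env A) :
    NucBound (secrecyDefect (Fin n → ZMod 2) (π.Transcript n × A.E) ((1 / 2 ^ n : ℝ) : ℂ)
        (finalStateTerm A n p))
      (∑ d : {d : Data π.N // π.keyLength d = n}, defectBound A (NU d) α ζ d p) := by
  classical
  rw [finalStateTerm_eq, map_sum]
  refine NucBound.sum _ fun d _ => ?_
  obtain ⟨c, hc, hsum⟩ := exists_nucBound_eveState A d.1 (NU d) hζ (hPA d) p d.2 hα
  rw [map_smul]
  simp only [map_sum (secrecyDefect _ _ _) _ (Finset.univ : Finset (Fin (π.NEC d) → ZMod 2)),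
    map_sum (secrecyDefect _ _ _) _ (Finset.univ : Finset π.Seed),
    map_sum (secrecyDefect _ _ _) _ (Finset.univ : Finset (Fin π.ζ' → ZMod 2)),
    map_sum (secrecyDefect _ _ _) _ (Finset.univ : Finset (PAMatrix n d.1)),
    secrecyDefect_sum_ketBra]
  refine NucBound.mono (NucBound.smul (NucBound.sum _ fun σ _ => NucBound.sum _ fun seed _ =>
    NucBound.sum _ fun τ _ => NucBound.sum _ fun M _ => NucBound.sum _ fun k _ =>
      (NucBound.conjEmbed ?_ (inr k) : NucBound _ (c M k))) _) ?_
  · rw [← conjEmbed_sum, ← conjEmbed_smul, ← conjEmbed_sub]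
    exact (hc M k).conjEmbed _
  · rw [Complex.norm_real, Real.norm_of_nonneg (div_nonneg (π.dataProb_nonneg d.1)
      (mul_nonneg (by positivity) (Nat.cast_nonneg _)))]
    -- The bound does not depend on the pads or the seed, so these sums cancel against the
    -- normalisation; the average over `M` remains.
    simp only [Finset.sum_const, nsmul_eq_mul, Finset.card_univ (α := Fin (π.NEC d) → ZMod 2),
      Finset.card_univ (α := π.Seed), Finset.card_univ (α := Fin π.ζ' → ZMod 2),
      Fintype.card_fun, ZMod.card, Fintype.card_fin]
    push_cast
    refine div_mul_sum_le (by positivity) (by exact_mod_cast Fintype.card_pos) (by positivity)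
      (π.dataProb_nonneg d.1) (Nat.cast_nonneg _) ?_ hsum
    have hW : 0 ≤ weight A d.1 p := Finset.sum_nonneg fun o _ => by positivity
    have hB : 0 ≤ badWeight A d.1 (NU d) p := Finset.sum_nonneg fun o _ => by positivity
    exact add_nonneg (mul_nonneg hα.le hB) (mul_nonneg (by positivity) hW)

/-- The total bound for the data `d`. -/
def defectTotal (B : ℝ≥0) (α ζ : ℝ) (d : Data π.N) : ℝ :=
  π.dataProb d * (α * ∑ o : π.Fiber d with (B : ℝ) < numPhaseErrors o.1.1 o.1.2,
      ∑' p : π.Env A, ‖π.eveVec A virtualAmp o.1 p‖ ^ 2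
    + (α * 2 ^ (-ζ) + 2 / α) * ∑ o : π.Fiber d, ∑' p : π.Env A, ‖π.eveVec A keyAmp o.1 p‖ ^ 2)

theorem hasSum_defectBound (B : ℝ≥0) (α ζ : ℝ) (d : Data π.N) :
    HasSum (defectBound A B α ζ d) (defectTotal A B α ζ d) := by
  refine HasSum.mul_left _ (HasSum.add (HasSum.mul_left _ (hasSum_sum fun o _ => ?_))
    (HasSum.mul_left _ (hasSum_sum fun o _ => ?_)))
  · exact (π.summable_norm_sq_eveVec A virtualAmp o.1).hasSum
  · exact (π.summable_norm_sq_eveVec A keyAmp o.1).hasSum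

/-- Restoring the probability of the code/sample choices turns the bad weights into the phase error
probability and the total weights into a probability of at most `1`. -/
theorem sum_defectTotal_le (NU : Data π.N → ℝ≥0) {ε ζ α : ℝ} (hα : 0 < α)
    (hph : π.phaseErrorProb A NU ≤ ε) :
    ∑ d, defectTotal A (NU d) α ζ d ≤ α * (ε + 2 ^ (-ζ)) + 2 / α := by
  have h1 : ∑ d, π.dataProb d * ∑ o : π.Fiber d with (NU d : ℝ) < numPhaseErrors o.1.1 o.1.2,
      ∑' p : π.Env A, ‖π.eveVec A virtualAmp o.1 p‖ ^ 2 = π.phaseErrorProb A NU := by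
    simp only [Finset.sum_filter, Finset.mul_sum]
    rw [sum_fiber fun d o => π.dataProb d * if (NU d : ℝ) < numPhaseErrors o.1 o.2 then
      ∑' p : π.Env A, ‖π.eveVec A virtualAmp o p‖ ^ 2 else 0]
    refine Finset.sum_congr rfl fun o _ => ?_
    rw [mul_ite, mul_zero, ← labelProb_eq_dataProb]
    rfl
  have h2 : ∑ d, π.dataProb d * ∑ o : π.Fiber d, ∑' p : π.Env A, ‖π.eveVec A keyAmp o.1 p‖ ^ 2
      ≤ 1 := by
    simp only [Finset.mul_sum]
    rw [sum_fiber fun d o => π.dataProb d * ∑' p : π.Env A, ‖π.eveVec A keyAmp o p‖ ^ 2]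
    simp only [← labelProb_eq_dataProb, ← tsum_mul_left]
    rw [← Summable.tsum_finsetSum fun o _ => (π.summable_norm_sq_eveVec A keyAmp o).mul_left _]
    exact π.tsum_sum_labelProb_mul_norm_sq_le A
  have h3 : ∑ d, defectTotal A (NU d) α ζ d = α * π.phaseErrorProb A NU
      + (α * 2 ^ (-ζ) + 2 / α) * ∑ d, π.dataProb d * ∑ o : π.Fiber d,
        ∑' p : π.Env A, ‖π.eveVec A keyAmp o.1 p‖ ^ 2 := by
    rw [← h1, Finset.mul_sum, Finset.mul_sum, ← Finset.sum_add_distrib]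
    refine Finset.sum_congr rfl fun d _ => ?_
    rw [defectTotal]
    ring
  rw [h3]
  have h4 : 0 ≤ α * (2 : ℝ) ^ (-ζ) + 2 / α := by positivity
  have h5 := mul_le_mul_of_nonneg_left h2 h4
  have h6 := mul_le_mul_of_nonneg_left hph hα.le
  linarith

theorem lengthProb_mul_traceNorm_le (NU : Data π.N → ℝ≥0) {ζ : ℝ} (hζ : 0 < ζ)
    (hPA : ∀ d, π.NPA d = numCode d * h (NU d / numCode d) + ζ) {α : ℝ} (hα : 0 < α) (n : ℕ) :
    ENNReal.ofReal (π.lengthProb A n) * traceNorm (π.finalState A n - π.idealState A n)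
      ≤ ENNReal.ofReal (∑ d : {d : Data π.N // π.keyLength d = n},
        defectTotal A (NU d) α ζ d) := by
  -- For an impossible length the prefactor vanishes; otherwise it cancels the normalisation of the
  -- conditional state.
  rcases le_or_gt (π.lengthProb A n) 0 with h0 | h0
  · rw [ENNReal.ofReal_of_nonpos h0, zero_mul]
    exact zero_le
  have h1 : π.finalState A n - π.idealState A n = (((π.lengthProb A n)⁻¹ : ℝ) : ℂ) •
      secrecyDefect (Fin n → ZMod 2) (π.Transcript n × A.E) ((1 / 2 ^ n : ℝ) : ℂ)
        (π.finalStateSub A n) := by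
    rw [← map_smul]
    rfl
  have h2 : NucBound (secrecyDefect (Fin n → ZMod 2) (π.Transcript n × A.E)
      ((1 / 2 ^ n : ℝ) : ℂ) (π.finalStateSub A n))
      (∑ d : {d : Data π.N // π.keyLength d = n}, defectTotal A (NU d) α ζ d) :=
    NucBound.hasSum ((hasSum_finalStateTerm A n).map _ (continuous_secrecyDefect _))
      (hasSum_sum fun d _ => hasSum_defectBound A (NU d) α ζ d.1)
      fun p => nucBound_secrecyDefect_term A NU hζ hPA hα n p
  rw [h1]
  refine (mul_le_mul_right (h2.smul _).traceNorm_le _).trans_eq ?_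
  rw [← ENNReal.ofReal_mul h0.le, Complex.norm_real, Real.norm_of_nonneg (inv_nonneg.2 h0.le),
    mul_inv_cancel_left₀ h0.ne']

theorem tsum_lengthProb_mul_traceNorm_le (NU : Data π.N → ℝ≥0) {ζ : ℝ} (hζ : 0 < ζ)
    (hPA : ∀ d, π.NPA d = numCode d * h (NU d / numCode d) + ζ) {α : ℝ} (hα : 0 < α) :
    ∑' n, ENNReal.ofReal (π.lengthProb A n) * traceNorm (π.finalState A n - π.idealState A n)
      ≤ ENNReal.ofReal (∑ d, defectTotal A (NU d) α ζ d) := by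
  have h0 : ∀ d, 0 ≤ defectTotal A (NU d) α ζ d := fun d =>
    (hasSum_defectBound A (NU d) α ζ d).nonneg fun p => defectBound_nonneg A (NU d) hα ζ d p
  refine (ENNReal.tsum_le_tsum fun n => lengthProb_mul_traceNorm_le A NU hζ hPA hα n).trans_eq ?_
  -- Each public data string determines one key length, so the sum over lengths is a regrouping of
  -- the sum over data.
  rw [ENNReal.ofReal_sum_of_nonneg fun d _ => h0 d, ← tsum_fintype (L := .unconditional _),
    ← (Equiv.sigmaFiberEquiv π.keyLength).tsum_eq, ENNReal.tsum_sigma']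
  refine tsum_congr fun n => ?_
  rw [ENNReal.ofReal_sum_of_nonneg fun d _ => h0 d.1, tsum_fintype]
  rfl


end Protocol

end DPS

end

theorem theorem2 {S R : Type} (π : DPS.Protocol S R) (𝒜 : Set (DPS.Attack S π.N))
    (NU : DPS.Data π.N → NNReal) (ε ζ : ℝ) (hε0 : 0 ≤ ε) (hε1 : ε ≤ 1) (hζ : 0 < ζ)
    (hph : ∀ A ∈ 𝒜, π.phaseErrorProb A NU ≤ ε)
    (hPA : ∀ d : DPS.Data π.N,
      π.NPA d = DPS.numCode d * DPS.h (NU d / DPS.numCode d) + ζ) :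
    π.IsSecret 𝒜 (√2 * √(ε + (2 : ℝ) ^ (-ζ))) := by
  intro A hA
  have hδ : 0 < ε + (2 : ℝ) ^ (-ζ) := by positivity
  set δ := ε + (2 : ℝ) ^ (-ζ)
  -- This `α` minimises `α * δ + 2 / α`, making both terms equal to `√2 * √δ`.
  have hα : 0 < √2 / √δ := by positivity
  refine (mul_le_mul_right ((DPS.Protocol.tsum_lengthProb_mul_traceNorm_le A NU hζ hPA hα).trans
    (ENNReal.ofReal_le_ofReal
      (DPS.Protocol.sum_defectTotal_le A NU hα (hph A hA)))) _).trans ?_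
  rw [show (1 / 2 : ENNReal) = ENNReal.ofReal (1 / 2) by
    rw [ENNReal.ofReal_div_of_pos two_pos]; simp, ← ENNReal.ofReal_mul (by norm_num)]
  refine ENNReal.ofReal_le_ofReal (le_of_eq ?_)
  have h1 : √2 * √2 = 2 := Real.mul_self_sqrt two_pos.le
  have h2 : √δ * √δ = δ := Real.mul_self_sqrt hδ.le
  have h3 : √δ ≠ 0 := by positivity
  have h4 : √2 ≠ 0 := by positivity
  change 1 / 2 * (√2 / √δ * δ + 2 / (√2 / √δ)) = √2 * √δ
  nth_rewrite 2 [← h2]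
  nth_rewrite 3 [← h1]
  field_simp
  ring
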